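/- Write $\|\cdot\|$ for the norm of $L^2(0,1)$, $s^+=\max(s,0)$, $\mathbb{R}_+=[0,\infty)$. Let $\varepsilon,\Gamma,\kappa,a,C>0$ be constants with $2\kappa>a$, let $\phi\in C^\infty(\mathbb{R};\mathbb{R}_+)$, and let $P_1,P_2,P_3\in C^\infty(\mathbb{R})$ satisfy for all $y\in\mathbb{R}$ $$P_1(y)\ge\tfrac{1}{4a\kappa^6}\bigl(\kappa+4aC+4\kappa^3+4a\kappa\phi(y)+8a\kappa^2\bigr),$$ $$P_2(y)\ge\tfrac{1}{4a^3\kappa^5}\Bigl(\tfrac{1}{16\kappa}\bigl(\kappa+4aC+4\kappa^3+4a\kappa\phi(y)\bigr)^2+\kappa^2+a^2\phi^2(y)+4a^2(\kappa^3+1)\Bigr),$$ $$P_3(y)\ge\tfrac{1}{64a^7\kappa^4}\Bigl(\bigl(\kappa^2+a^2\phi^2(y)\bigr)^2+16a^4\Bigr).$$ Let $c>0$ and let $L:H^1(0,1)\times\mathbb{R}\to\mathbb{R}$, $K_1:[0,1]\times\mathbb{R}\to\mathbb{R}$, $K_2:\mathbb{R}\to\mathbb{R}$ satisfy $$|L(w,y)|\le\|w\|+\phi(y)|y|,\qquad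 |K_1(x,y)|\le|y|,\qquad |K_2(y)|\le|y|$$ for all $x\in[0,1]$, $y\in\mathbb{R}$, $w\in H^1(0,1)$. Consider the closed-loop system $$w_t(t,x)+c\,w_x(t,x)=\theta_{1,1}(t,x)K_1(x,y(t))+\delta(t,x),\qquad w(t,0)=\theta_{1,2}(t)K_2(y(t)),$$ $$\dot y(t)=b(t)u(t)+\theta_2(t)L(w[t],y(t))+d(t),$$ $$u=-(\kappa+e^{z})^7\bigl(P_1(y)+P_2(y)y^2+P_3(y)y^6\bigr)y,\qquad \dot z=\Gamma e^{-z}\bigl(\tfrac12y^2-\varepsilon\bigr)^+,$$ with $x\in(0,1)$, where $d,\theta_2\in L^\infty(\mathbb{R}_+)$, $\theta_1=(\theta_{1,1},\theta_{1,2})\in L^\infty(\mathbb{R}_+;L^2(0,1)\times\mathbb{R})$, $\delta\in L^\infty(\mathbb{R}_+;L^2(0,1))$, $b\in L^\infty(\mathbb{R}_+;(0,\infty))$ with $b_*:=\inf_{t\ge0}b(t)>0$. For elements of $L^\infty$, the expressions $\inf$, $\lim$, $\liminf$, $\limsup$ are understood up to null sets of $t$. Let $\Phi(w)=\frac{2e}{c}\int_0^1e^{-x}w^2(x)\,dx$,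 and let $w\in C^0(\mathbb{R}_+;L^2(0,1))$ with $t\mapsto\Phi(w[t])$ locally absolutely continuous and $w\in L^1((0,T);H^1(0,1))$ for each $T>0$, $z\in C^1(\mathbb{R}_+)$, and $y\in C^0(\mathbb{R}_+)$ locally absolutely continuous be any solution, i.e. the equations above hold for almost every $t\ge0$ ($w_t$ being the derivative of $t\mapsto w[t]$ in $L^2(0,1)$, $w_x$ the weak derivative, $w(t,0)$ the boundary value of $w[t]\in H^1(0,1)$). Put $k_1=\frac2c$, $k_2=\frac{2e}{c}$, $R=\sqrt{2e}$, $G=\frac{8e^2}{c^2}$, $\|\theta_1\|_{\mathfrak U}=\sqrt{\theta_{1,2}^2+\frac{4e}{c^2}\|\theta_{1,1}\|^2}$, $g(s,l)=\bigl((s-\kappa-e^l)^+\bigr)^2$, $\mu=\min\bigl(\frac{2\kappa-a}{2\kappa k_2},2C\bigr)$, and, with $\|\cdot\|_\infty$ the essential supremum over $t\ge 0$ of the respective norm, $$Z=G\|\delta\|_\infty^2+\tfrac{a}{\kappa+e^{z(0)}}\Bigl(\|d\|_\infty^2+g(\|\theta_2\|_\infty,z(0))+g^2(\|\theta_2\|_\infty,z(0))+4b_*\,g(\tfrac1{b_*},z(0))+g^2(R\|\theta_1\|_\infty,z(0))\Bigr),$$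 $$B=\tfrac1{2k_1}\bigl(k_2\|w[0]\|^2+\tfrac12|y(0)|^2+\mu^{-1}Z\bigr)+g(\|\theta_2\|_\infty,z(0))+\|d\|_\infty^2+g^2(\|\theta_2\|_\infty,z(0))+2b_*\,g(\tfrac1{b_*},z(0)).$$ Then for all $t\ge0$ $$2k_1\|w[t]\|^2+|y(t)|^2\le e^{-\mu t}\bigl(2k_2\|w[0]\|^2+|y(0)|^2\bigr)+2\mu^{-1}Z,$$ $$z(0)\le z(t)\le\ln\Bigl(e^{z(0)}+\tfrac{\Gamma}{4C}|y(0)|^2+aB\,\tfrac{2C(1+e^{z(0)})+\varepsilon\Gamma}{4C^2\varepsilon\min(1,\kappa)(1+e^{z(0)})}\Bigr),$$ and $$\limsup_{t\to\infty}\|w[t]\|\le\sqrt{\tfrac{k_2}{k_1}\Bigl(2\varepsilon R^2\bigl(\limsup_{t\to\infty}\|\theta_1[t]\|_{\mathfrak U}\bigr)^2+G\bigl(\limsup_{t\to\infty}\|\delta[t]\|\bigr)^2\Bigr)},\qquad \limsup_{t\to\infty}|y(t)|\le\sqrt{2\varepsilon}.$$ Finally, if $\lim_{t\to\infty}d(t)=0$,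 $\lim_{t\to\infty}\delta[t]=0$ in $L^2(0,1)$ and $\liminf_{t\to\infty}b(t)\ge1/\kappa$, then $\lim_{t\to\infty}z(t)$ exists in $\mathbb{R}$ and either $\lim_{t\to\infty}|y(t)|=\lim_{t\to\infty}\|w[t]\|=0$ or $$\kappa+\exp\Bigl(\lim_{s\to\infty}z(s)\Bigr)<\limsup_{t\to\infty}\,\max\Bigl(\sqrt{2e\,\theta_{1,2}^2(t)+\tfrac{8e^2}{c^2}\|\theta_{1,1}[t]\|^2},\;|\theta_2(t)|\Bigr).$$ -/

import Mathlib

open MeasureTheory Filter Set Topology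
open scoped ContDiff ENNReal

noncomputable section

namespace DADS

/-- Lebesgue measure on the unit interval `(0,1)`. -/
abbrev unitMeasure : Measure ℝ := volume.restrict (Ioo (0 : ℝ) 1)

/-- Lebesgue measure on the time axis `[0, ∞)`. -/
abbrev timeMeasure : Measure ℝ := volume.restrict (Ici (0 : ℝ))

/-- The space `L²(0,1)` of real-valued functions. -/
abbrev L2 : Type := Lp ℝ 2 unitMeasure

/-- `g` is the weak derivative of `f` on `(0,1)`. -/
def IsWeakDeriv (f g : L2) : Prop :=
  ∀ ψ : ℝ → ℝ, ContDiff ℝ 1 ψ → HasCompactSupport ψ → tsupport ψ ⊆ Ioo (0 : ℝ) 1 →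
    ∫ x, f x * deriv ψ x ∂unitMeasure = -∫ x, g x * ψ x ∂unitMeasure

theorem integrable_mul_of_continuous (f : L2) {ψ : ℝ → ℝ} (hψ : Continuous ψ)
    (hs : HasCompactSupport ψ) : Integrable (fun x => f x * ψ x) unitMeasure := by
  have h1 : MemLp ψ 2 unitMeasure := (hψ.memLp_of_hasCompactSupport hs).restrict _
  exact (Lp.memLp f).integrable_mul h1

/-- The pairs `(f, f')` in `L²(0,1) × L²(0,1)` such that `f'` is the weak derivative of `f`. -/
def h1Submodule : Submodule ℝ (WithLp 2 (L2 × L2)) where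
  carrier := {p | IsWeakDeriv p.fst p.snd}
  zero_mem' := by
    intro ψ _ _ _
    have h0 : ∀ χ : ℝ → ℝ, ∫ x, (0 : L2) x * χ x ∂unitMeasure = 0 := by
      intro χ
      refine integral_eq_zero_of_ae ?_
      filter_upwards [Lp.coeFn_zero ℝ 2 unitMeasure] with x hx
      have hx' : (0 : L2) x = 0 := hx
      rw [hx', zero_mul, Pi.zero_apply]
    change ∫ x, (0 : L2) x * deriv ψ x ∂unitMeasure = -∫ x, (0 : L2) x * ψ x ∂unitMeasure
    rw [h0, h0, neg_zero]
  add_mem' := by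
    intro p q hp hq ψ h1 h2 h3
    have key : ∀ (f g : L2) (χ : ℝ → ℝ), Continuous χ → HasCompactSupport χ →
        ∫ x, (f + g : L2) x * χ x ∂unitMeasure
          = ∫ x, f x * χ x ∂unitMeasure + ∫ x, g x * χ x ∂unitMeasure := by
      intro f g χ hc hs
      rw [← integral_add (integrable_mul_of_continuous f hc hs)
        (integrable_mul_of_continuous g hc hs)]
      refine integral_congr_ae ?_
      filter_upwards [Lp.coeFn_add f g] with x hx
      rw [hx, Pi.add_apply, add_mul]
    have hp' := hp ψ h1 h2 h3
    have hq' := hq ψ h1 h2 h3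
    have hd : Continuous (deriv ψ) := h1.continuous_deriv le_rfl
    change ∫ x, (p.fst + q.fst : L2) x * deriv ψ x ∂unitMeasure
      = -∫ x, (p.snd + q.snd : L2) x * ψ x ∂unitMeasure
    rw [key _ _ _ hd h2.deriv, key _ _ _ h1.continuous h2, hp', hq', neg_add]
  smul_mem' := by
    intro r p hp ψ h1 h2 h3
    have key : ∀ (f : L2) (χ : ℝ → ℝ),
        ∫ x, (r • f : L2) x * χ x ∂unitMeasure = r * ∫ x, f x * χ x ∂unitMeasure := by
      intro f χ
      rw [← integral_const_mul]
      refine integral_congr_ae ?_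
      filter_upwards [Lp.coeFn_smul r f] with x hx
      rw [hx, Pi.smul_apply, smul_eq_mul, mul_assoc]
    have hp' := hp ψ h1 h2 h3
    change ∫ x, (r • p.fst : L2) x * deriv ψ x ∂unitMeasure
      = -∫ x, (r • p.snd : L2) x * ψ x ∂unitMeasure
    rw [key, key, hp', mul_neg]

/-- The Sobolev space `H¹(0,1)` with its usual norm `(‖f‖² + ‖f'‖²)^(1/2)`; an element is carried
together with its weak derivative, which it determines. -/
abbrev H1 : Type := h1Submodule

/-- The underlying `L²` function of an element of `H¹(0,1)`. -/
def H1.toL2 (f : H1) : L2 := (f : WithLp 2 (L2 × L2)).fst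

/-- The weak derivative `f_x` of an element of `H¹(0,1)`. -/
def H1.dx (f : H1) : L2 := (f : WithLp 2 (L2 × L2)).snd

/-- The boundary value at `x = 0` of an element of `H¹(0,1)` is `v`: its representative that is
continuous on `[0,1]` takes the value `v` at `0`. -/
def H1.HasValueAtZero (f : H1) (v : ℝ) : Prop :=
  ∃ F : ℝ → ℝ, ContinuousOn F (Icc 0 1) ∧ (f.toL2 : ℝ → ℝ) =ᵐ[unitMeasure] F ∧ F 0 = v

/-- Local absolute continuity on `[0, ∞)`. -/
def LocallyAC (f : ℝ → ℝ) : Prop := ∀ T : ℝ, 0 < T → AbsolutelyContinuousOnInterval f 0 T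

/-- The norm of `L^∞(ℝ₊; E)`. -/
def supNorm {E : Type} [NormedAddCommGroup E] (f : ℝ → E) : ℝ :=
  (eLpNorm f ∞ timeMeasure).toReal

/-- The filter of `t → +∞` up to null sets. Limits, upper limits and lower limits of elements of
`L^∞(ℝ₊)`, which are classes of functions modulo null sets, are taken along it. -/
def essTop : Filter ℝ := atTop ⊓ ae volume

/-- The controller constants. -/
structure Gains where
  ε : ℝ
  Γ : ℝ
  κ : ℝ
  a : ℝ
  C : ℝ

/-- The controller constants are positive and `2κ > a`. -/
structure Gains.Valid (p : Gains) : Prop where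
  ε_pos : 0 < p.ε
  Γ_pos : 0 < p.Γ
  κ_pos : 0 < p.κ
  a_pos : 0 < p.a
  C_pos : 0 < p.C
  two_κ_gt : p.a < 2 * p.κ

/-- The smooth functions `P₁, P₂, P₃` of the controller, with the lower bounds they must satisfy
for the given constants and the given function `φ`. -/
structure IsDesign (p : Gains) (φ P₁ P₂ P₃ : ℝ → ℝ) : Prop where
  smooth₁ : ContDiff ℝ ∞ P₁
  smooth₂ : ContDiff ℝ ∞ P₂
  smooth₃ : ContDiff ℝ ∞ P₃
  bound₁ : ∀ y : ℝ, 1 / (4 * p.a * p.κ ^ 6) *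
    (p.κ + 4 * p.a * p.C + 4 * p.κ ^ 3 + 4 * p.a * p.κ * φ y + 8 * p.a * p.κ ^ 2) ≤ P₁ y
  bound₂ : ∀ y : ℝ, 1 / (4 * p.a ^ 3 * p.κ ^ 5) *
    (1 / (16 * p.κ) * (p.κ + 4 * p.a * p.C + 4 * p.κ ^ 3 + 4 * p.a * p.κ * φ y) ^ 2
      + p.κ ^ 2 + p.a ^ 2 * φ y ^ 2 + 4 * p.a ^ 2 * (p.κ ^ 3 + 1)) ≤ P₂ y
  bound₃ : ∀ y : ℝ, 1 / (64 * p.a ^ 7 * p.κ ^ 4) *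
    ((p.κ ^ 2 + p.a ^ 2 * φ y ^ 2) ^ 2 + 16 * p.a ^ 4) ≤ P₃ y

/-- The feedback `u = -(κ + exp z)⁷ (P₁(y) + P₂(y) y² + P₃(y) y⁶) y`. -/
def feedback (p : Gains) (P₁ P₂ P₃ : ℝ → ℝ) (z y : ℝ) : ℝ :=
  -(p.κ + Real.exp z) ^ 7 * (P₁ y + P₂ y * y ^ 2 + P₃ y * y ^ 6) * y

/-- The right-hand side `Γ exp(-z) (y²/2 - ε)⁺` of the update law of the dynamic gain. -/
def updateLaw (p : Gains) (z y : ℝ) : ℝ :=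
  p.Γ * Real.exp (-z) * max (y ^ 2 / 2 - p.ε) 0

/-- The bounds on the unknown functional `L` and the unknown functions `K₁`, `K₂`. -/
structure UncertaintyBounds (φ : ℝ → ℝ) (L : H1 → ℝ → ℝ) (K₁ : ℝ → ℝ → ℝ) (K₂ : ℝ → ℝ) :
    Prop where
  L_le : ∀ (w : H1) (y : ℝ), |L w y| ≤ ‖w.toL2‖ + φ y * |y|
  K₁_le : ∀ x ∈ Icc (0 : ℝ) 1, ∀ y : ℝ, |K₁ x y| ≤ |y|
  K₂_le : ∀ y : ℝ, |K₂ y| ≤ |y|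

/-- The time-varying parameters and disturbances of the system. -/
structure Inputs where
  d : ℝ → ℝ
  θ₁₁ : ℝ → L2
  θ₁₂ : ℝ → ℝ
  θ₂ : ℝ → ℝ
  δ : ℝ → L2
  b : ℝ → ℝ

/-- All inputs are of class `L^∞` on `[0, ∞)`, and `b` is positive and bounded away from `0`. -/
structure Inputs.Admissible (i : Inputs) : Prop where
  d_mem : MemLp i.d ∞ timeMeasure
  θ₁₁_mem : MemLp i.θ₁₁ ∞ timeMeasure
  θ₁₂_mem : MemLp i.θ₁₂ ∞ timeMeasure
  θ₂_mem : MemLp i.θ₂ ∞ timeMeasure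
  δ_mem : MemLp i.δ ∞ timeMeasure
  b_mem : MemLp i.b ∞ timeMeasure
  b_pos : ∀ᵐ t ∂timeMeasure, 0 < i.b t
  b_inf_pos : 0 < essInf i.b timeMeasure

/-- `Φ(w) = (2e/c) ∫₀¹ exp(-x) w(x)² dx`. -/
def Phi (c : ℝ) (w : L2) : ℝ :=
  2 * Real.exp 1 / c * ∫ x, Real.exp (-x) * w x ^ 2 ∂unitMeasure

/-- `(w, y, z)` is a solution on `[0, ∞)` of the closed loop of the system
`w_t + c w_x = θ₁₁ K₁(x,y) + δ`, `w(t,0) = θ₁₂ K₂(y)`, `y' = b u + θ₂ L(w,y) + d`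
with the adaptive controller. The time derivative `w_t` is the derivative of `t ↦ w[t]` in
`L²(0,1)`; `W t` is `w t` seen as an element of `H¹(0,1)`, for almost every `t`. -/
structure IsSolution (p : Gains) (P₁ P₂ P₃ : ℝ → ℝ) (c : ℝ) (L : H1 → ℝ → ℝ)
    (K₁ : ℝ → ℝ → ℝ) (K₂ : ℝ → ℝ) (i : Inputs)
    (w : ℝ → L2) (W : ℝ → H1) (y z : ℝ → ℝ) : Prop where
  w_cont : ContinuousOn w (Ici 0)
  Phi_ac : LocallyAC (fun t => Phi c (w t))
  w_mem_H1 : ∀ᵐ t ∂timeMeasure, (W t).toL2 = w t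
  w_L1_H1 : ∀ T : ℝ, 0 < T → IntegrableOn W (Ioo 0 T)
  z_C1 : ContDiffOn ℝ 1 z (Ici 0)
  y_cont : ContinuousOn y (Ici 0)
  y_ac : LocallyAC y
  pde : ∀ᵐ t ∂timeMeasure, ∃ wt : L2, HasDerivAt w wt t ∧
    ∀ᵐ x ∂unitMeasure, wt x + c * (W t).dx x = i.θ₁₁ t x * K₁ x (y t) + i.δ t x
  boundary : ∀ᵐ t ∂timeMeasure, (W t).HasValueAtZero (i.θ₁₂ t * K₂ (y t))
  ode : ∀ᵐ t ∂timeMeasure, HasDerivAt y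
    (i.b t * feedback p P₁ P₂ P₃ (z t) (y t) + i.θ₂ t * L (W t) (y t) + i.d t) t
  gain : ∀ᵐ t ∂timeMeasure, HasDerivAt z (updateLaw p (z t) (y t)) t

/-- The lower constant `2/c` in `(2/c) ‖w‖² ≤ Φ(w)`. -/
def lowerConst (c : ℝ) : ℝ := 2 / c

/-- The upper constant `2e/c` in `Φ(w) ≤ (2e/c) ‖w‖²`. -/
def upperConst (c : ℝ) : ℝ := 2 * Real.exp 1 / c

/-- `R = √(2e)`. -/
def R : ℝ := Real.sqrt (2 * Real.exp 1)

/-- `G = 8e²/c²`. -/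
def G (c : ℝ) : ℝ := 8 * Real.exp 1 ^ 2 / c ^ 2

/-- The norm `√(θ₁₂² + (4e/c²) ‖θ₁₁‖²)` on `L²(0,1) × ℝ`. -/
def paramNorm (c : ℝ) (θ₁₁ : L2) (θ₁₂ : ℝ) : ℝ :=
  Real.sqrt (θ₁₂ ^ 2 + 4 * Real.exp 1 / c ^ 2 * ‖θ₁₁‖ ^ 2)

/-- `g(s, l) = ((s - κ - exp l)⁺)²`. -/
def gFun (κ s l : ℝ) : ℝ := max (s - κ - Real.exp l) 0 ^ 2

/-- The decay rate `μ = min ((2κ - a)/(2κ k₂), 2C)`, with `k₂ = 2e/c`. -/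
def mu (p : Gains) (c : ℝ) : ℝ :=
  min ((2 * p.κ - p.a) / (2 * p.κ * upperConst c)) (2 * p.C)

/-- The constant `Z` for the initial gain `z₀`. -/
def ZConst (p : Gains) (c : ℝ) (i : Inputs) (z₀ : ℝ) : ℝ :=
  G c * supNorm i.δ ^ 2
    + p.a / (p.κ + Real.exp z₀) *
      (supNorm i.d ^ 2 + gFun p.κ (supNorm i.θ₂) z₀ + gFun p.κ (supNorm i.θ₂) z₀ ^ 2)
    + p.a / (p.κ + Real.exp z₀) *
      (4 * essInf i.b timeMeasure * gFun p.κ (1 / essInf i.b timeMeasure) z₀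
        + gFun p.κ (R * supNorm (fun t => paramNorm c (i.θ₁₁ t) (i.θ₁₂ t))) z₀ ^ 2)

/-- The constant `B` for the initial state `(w₀, y₀, z₀)`. -/
def BConst (p : Gains) (c : ℝ) (i : Inputs) (w₀ : L2) (y₀ z₀ : ℝ) : ℝ :=
  1 / (2 * lowerConst c) *
      (upperConst c * ‖w₀‖ ^ 2 + 1 / 2 * |y₀| ^ 2 + (mu p c)⁻¹ * ZConst p c i z₀)
    + gFun p.κ (supNorm i.θ₂) z₀ + supNorm i.d ^ 2 + gFun p.κ (supNorm i.θ₂) z₀ ^ 2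
    + 2 * essInf i.b timeMeasure * gFun p.κ (1 / essInf i.b timeMeasure) z₀

end DADS

end

/-! Write q = κ + e^z, ζ = e^z, Y = y²/2. Integrating e^{-x} w w_x by parts gives Φ' ≤ -‖w‖² +
(R‖θ₁‖)² y² + G‖δ‖² (`transport_dissipation`). In the y-equation each unknown coefficient is split
at the level q: the part below q is dominated by the high powers of q and y in the feedback, and the
excess over q is traded by Young's inequality for an error a/q times a power of that excess. These
errors are the functions g.

The same feedback supports two estimates, which differ in the weight put on ‖w‖². With the fixed
weight a/(2κ) < 1, `control_bound_with_coupling` also absorbs the term (R‖θ₁‖)² y² produced by Φ, so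
V = Φ + Y obeys V' ≤ -μV + Z, and Grönwall bounds w and y. With the weight a/(2q), `control_bound`
gives Y' ≤ -2CY + aB/q, whose forcing decays as the gain grows.

Since ζ' = Γ(Y - ε)⁺, once ζ is so large that the forcing is below 2Cε the quantity ζ + Γ/(2C) (Y -
ε)⁺ cannot increase; this bounds z (`deadzone_gain_bound`). Being monotone, z converges; a one-sided
Barbalat argument then drives Y into the dead zone, and inserting |y|² ≲ 2ε into the dissipation of
Φ yields the upper limit of ‖w‖.

If d and δ vanish at infinity, liminf b ≥ 1/κ, and lim q is at least the upper limit of the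
parameters, every excess over q vanishes in the limit. The forcing of V then tends to 0 and so does
V (`tendsto_lyapunov_zero`); this is the final alternative. -/

section AbsoluteContinuity

/-! ### Comparison principles for absolutely continuous functions. -/

namespace AbsolutelyContinuousOnInterval

/-- An absolutely continuous function whose derivative is a.e. nonpositive does not increase. -/
theorem le_of_ae_deriv_nonpos {f : ℝ → ℝ} {a b : ℝ} (hab : a ≤ b)
    (hf : AbsolutelyContinuousOnInterval f a b) (h : ∀ᵐ t, t ∈ Icc a b → deriv f t ≤ 0) :
    f b ≤ f a := by
  have h1 : ∫ t in a..b, deriv f t ≤ 0 := by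
    rw [intervalIntegral.integral_of_le hab]
    refine integral_nonpos_of_ae ?_
    rw [EventuallyLE, ae_restrict_iff' measurableSet_Ioc]
    filter_upwards [h] with t ht hmem using ht (Ioc_subset_Icc_self hmem)
  rw [hf.integral_deriv_eq_sub] at h1
  linarith

theorem const (a b m : ℝ) : AbsolutelyContinuousOnInterval (fun _ => m) a b :=
  contDiffOn_const.absolutelyContinuousOnInterval

/-- Grönwall's inequality for absolutely continuous functions. -/
theorem gronwall {f : ℝ → ℝ} {a b μ K : ℝ} (hab : a ≤ b)
    (hf : AbsolutelyContinuousOnInterval f a b)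
    (h : ∀ᵐ t, t ∈ Icc a b → deriv f t ≤ -μ * f t + μ * K) :
    f b ≤ K + Real.exp (-μ * (b - a)) * (f a - K) := by
  -- Integrating factor normalized to 1 at the right endpoint; its product with f - K does not
  -- increase.
  have hE : AbsolutelyContinuousOnInterval (fun t => Real.exp (μ * (t - b))) a b :=
    ContDiffOn.absolutelyContinuousOnInterval (by fun_prop)
  have hg := hE.mul (hf.sub (const a b K))
  have h2 := hg.le_of_ae_deriv_nonpos hab (by
    filter_upwards [h, hf.ae_differentiableAt] with t ht hd hmem
    have h3 := ht hmem
    have h4 := (hd (by rwa [uIcc_of_le hab])).hasDerivAt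
    have h5 : HasDerivAt (fun t => Real.exp (μ * (t - b)))
        (Real.exp (μ * (t - b)) * (μ * 1)) t :=
      (((hasDerivAt_id t).sub_const b).const_mul μ).exp
    have h6 := h5.mul (h4.sub (hasDerivAt_const t K))
    rw [h6.deriv]
    have h7 := Real.exp_pos (μ * (t - b))
    simp only [Pi.sub_apply]
    nlinarith)
  simp only [Pi.mul_apply, Pi.sub_apply, sub_self, mul_zero, Real.exp_zero, one_mul] at h2
  have h8 : -μ * (b - a) = μ * (a - b) := by ring
  rw [h8]
  linarith

/-- The positive part is 1-Lipschitz, so the variation sums of f dominate those of its positive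
part. -/
theorem max_zero {f : ℝ → ℝ} {a b : ℝ} (hf : AbsolutelyContinuousOnInterval f a b) :
    AbsolutelyContinuousOnInterval (fun t => max (f t) 0) a b := by
  refine squeeze_zero (fun t => Finset.sum_nonneg fun i _ => dist_nonneg) (fun t => ?_) hf
  refine Finset.sum_le_sum fun i _ => ?_
  simp only [Real.dist_eq]
  simpa using abs_max_sub_max_le_max (f (t.2 i).1) 0 (f (t.2 i).2) 0

end AbsolutelyContinuousOnInterval

/-- The derivative of a positive part, with the convention that it is `0` where it does not
exist. -/
theorem deriv_max_zero {f : ℝ → ℝ} {t : ℝ} (hf : DifferentiableAt ℝ f t) :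
    (0 < f t ∧ deriv (fun s => max (f s) 0) t = deriv f t) ∨
      (f t ≤ 0 ∧ deriv (fun s => max (f s) 0) t = 0) := by
  rcases lt_or_ge 0 (f t) with h0 | h0
  · refine Or.inl ⟨h0, Filter.EventuallyEq.deriv_eq ?_⟩
    filter_upwards [hf.continuousAt.eventually (lt_mem_nhds h0)] with s hs
    exact max_eq_left hs.le
  -- The positive part attains its minimum 0 at t; `deriv` is 0 at a local minimum even where the
  -- function is not differentiable.
  · refine Or.inr ⟨h0, IsLocalMin.deriv_eq_zero ?_⟩
    refine Eventually.of_forall fun s => ?_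
    simp only [max_eq_right h0]
    exact le_max_right _ _

end AbsoluteContinuity

/-! ### Local absolute continuity, essential limits and Barbalat's lemma. -/

namespace DADS

theorem LocallyAC.interval {f : ℝ → ℝ} (hf : LocallyAC f) {a b : ℝ} (ha : 0 ≤ a) (hab : a ≤ b) :
    AbsolutelyContinuousOnInterval f a b := by
  refine (hf (b + 1) (by linarith)).mono ?_
  rw [uIcc_of_le hab, uIcc_of_le (by linarith)]
  exact Icc_subset_Icc ha (by linarith)

theorem LocallyAC.add {f g : ℝ → ℝ} (hf : LocallyAC f) (hg : LocallyAC g) :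
    LocallyAC (fun t => f t + g t) := fun T hT => (hf T hT).add (hg T hT)

theorem LocallyAC.mul {f g : ℝ → ℝ} (hf : LocallyAC f) (hg : LocallyAC g) :
    LocallyAC (fun t => f t * g t) := fun T hT => (hf T hT).mul (hg T hT)

theorem LocallyAC.of_contDiffOn {f : ℝ → ℝ} (hf : ContDiffOn ℝ 1 f (Ici 0)) : LocallyAC f := by
  intro T hT
  refine (hf.mono ?_).absolutelyContinuousOnInterval
  rw [uIcc_of_le hT.le]
  exact Icc_subset_Ici_self

theorem LocallyAC.const (m : ℝ) : LocallyAC (fun _ => m) :=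
  LocallyAC.of_contDiffOn contDiffOn_const

theorem LocallyAC.max_zero {f : ℝ → ℝ} (hf : LocallyAC f) :
    LocallyAC (fun t => max (f t) 0) := fun T hT => (hf T hT).max_zero

theorem LocallyAC.ae_differentiableAt {f : ℝ → ℝ} (hf : LocallyAC f) :
    ∀ᵐ t, 0 ≤ t → DifferentiableAt ℝ f t := by
  have h : ∀ n : ℕ, ∀ᵐ t, t ∈ uIcc (0 : ℝ) (n + 1) → DifferentiableAt ℝ f t := fun n =>
    (hf (n + 1) (by positivity)).ae_differentiableAt
  filter_upwards [ae_all_iff.2 h] with t ht h0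
  obtain ⟨n, hn⟩ := exists_nat_ge t
  refine ht n ?_
  rw [uIcc_of_le (by positivity)]
  exact ⟨h0, by linarith⟩

theorem ae_timeMeasure_iff {P : ℝ → Prop} :
    (∀ᵐ t ∂timeMeasure, P t) ↔ ∀ᵐ t, 0 ≤ t → P t :=
  ae_restrict_iff' measurableSet_Ici

theorem eventually_essTop_iff {P : ℝ → Prop} :
    (∀ᶠ t in essTop, P t) ↔ ∃ T : ℝ, 0 ≤ T ∧ ∀ᵐ t, T ≤ t → P t := by
  unfold essTop
  rw [Filter.eventually_inf]
  constructor
  · rintro ⟨s, hs, u, hu, h⟩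
    obtain ⟨T, hT⟩ := mem_atTop_sets.1 hs
    refine ⟨max T 0, le_max_right _ _, ?_⟩
    filter_upwards [hu] with t ht hTt
    exact h t ⟨hT t ((le_max_left _ _).trans hTt), ht⟩
  · rintro ⟨T, -, h⟩
    exact ⟨Ici T, Ici_mem_atTop T, {t | T ≤ t → P t}, h, fun t ht => ht.2 ht.1⟩

theorem eventually_essTop_of_ae {P : ℝ → Prop} (h : ∀ᵐ t ∂timeMeasure, P t) :
    ∀ᶠ t in essTop, P t :=
  eventually_essTop_iff.2 ⟨0, le_rfl, ae_timeMeasure_iff.1 h⟩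

/-- A locally absolutely continuous function satisfying `f' ≤ -μ f + μ K` eventually a.e. is
eventually below any number larger than `K`. -/
theorem LocallyAC.eventually_lt {f : ℝ → ℝ} (hf : LocallyAC f) {μ K M : ℝ} (hμ : 0 < μ)
    (hKM : K < M) (h : ∀ᶠ t in essTop, deriv f t ≤ -μ * f t + μ * K) :
    ∀ᶠ t in atTop, f t < M := by
  obtain ⟨T, hT0, hT⟩ := eventually_essTop_iff.1 h
  have h1 : Tendsto (fun t => K + Real.exp (-μ * (t - T)) * (f T - K)) atTop
      (𝓝 (K + 0 * (f T - K))) := by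
    refine tendsto_const_nhds.add (Tendsto.mul_const _ ?_)
    refine Real.tendsto_exp_atBot.comp ?_
    exact Tendsto.const_mul_atTop_of_neg (by linarith) (tendsto_atTop_add_const_right _ _ tendsto_id)
  rw [zero_mul, add_zero] at h1
  filter_upwards [h1.eventually (gt_mem_nhds hKM), eventually_ge_atTop T] with t ht hTt
  refine lt_of_le_of_lt ((hf.interval hT0 hTt).gronwall hTt ?_) ht
  filter_upwards [hT] with s hs hmem using hs hmem.1

/-- A one-sided Barbalat lemma. -/
theorem LocallyAC.tendsto_zero_of_bounded_primitive {h ζ : ℝ → ℝ} (hh : LocallyAC h)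
    (hζ : LocallyAC ζ) {M Γ : ℝ} (hΓ : 0 < Γ) (h0 : ∀ t, 0 ≤ h t)
    (hM : ∀ᵐ t ∂timeMeasure, deriv h t ≤ M)
    (hd : ∀ᵐ t ∂timeMeasure, deriv ζ t = Γ * h t) {l : ℝ} (hl : Tendsto ζ atTop (𝓝 l)) :
    Tendsto h atTop (𝓝 0) := by
  -- Enlarging M is harmless and makes the window length η / (2M) meaningful.
  wlog hMpos : 0 < M generalizing M
  · exact this (M := max M 1) (hM.mono fun t ht => ht.trans (le_max_left _ _)) (by positivity)
  rw [ae_timeMeasure_iff] at hM hd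
  -- As h climbs at rate at most M, it is at least h t - Mτ throughout [t - τ, t], which forces ζ to
  -- grow there.
  have key : ∀ τ > 0, ∀ t ≥ τ, Γ * τ * (h t - M * τ) ≤ ζ t - ζ (t - τ) := by
    intro τ hτ t ht
    have h1 : ∀ s ∈ Icc (t - τ) t, h t - M * τ ≤ h s := by
      intro s hs
      have h2 := ((hh.interval (a := s) (b := t) (by linarith [hs.1]) hs.2).sub
        (LocallyAC.interval (f := fun r => M * r)
          (LocallyAC.of_contDiffOn (by fun_prop)) (by linarith [hs.1]) hs.2)).le_of_ae_deriv_nonpos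
          hs.2 (by
            filter_upwards [hM, hh.ae_differentiableAt] with r hr hdr hmem
            have hr0 : 0 ≤ r := by linarith [hs.1, hmem.1]
            have h3 := (hdr hr0).hasDerivAt.sub ((hasDerivAt_id r).const_mul M)
            have h4 := hr hr0
            have h5 := h3.deriv
            simp only [id] at h5
            rw [h5]
            linarith)
      simp only [Pi.sub_apply] at h2
      nlinarith [hs.1]
    have h2 := ((LocallyAC.interval (f := fun r => (Γ * (h t - M * τ)) * r)
          (LocallyAC.of_contDiffOn (by fun_prop)) (by linarith : 0 ≤ t - τ)
          (by linarith : t - τ ≤ t)).sub (hζ.interval (by linarith) (by linarith))).le_of_ae_deriv_nonpos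
          (by linarith) (by
            filter_upwards [hd, hζ.ae_differentiableAt] with r hr hdr hmem
            have hr0 : 0 ≤ r := by linarith [hmem.1]
            have h3 := ((hasDerivAt_id r).const_mul (Γ * (h t - M * τ))).sub (hdr hr0).hasDerivAt
            have h5 := h3.deriv
            simp only [id] at h5
            rw [h5, hr hr0]
            have := mul_le_mul_of_nonneg_left (h1 r hmem) hΓ.le
            linarith)
    simp only [Pi.sub_apply] at h2
    linarith
  rw [Metric.tendsto_atTop']
  intro η hη
  -- Chosen so that Mτ = η/2; the other η/2 comes from the vanishing increments of the convergent ζ.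
  set τ := η / (2 * M) with hτd
  have hτ : 0 < τ := by positivity
  have h1 : Tendsto (fun t => ζ t - ζ (t - τ)) atTop (𝓝 (l - l)) :=
    hl.sub (hl.comp (tendsto_atTop_add_const_right _ _ tendsto_id))
  rw [sub_self] at h1
  have h2 := (h1.eventually (gt_mem_nhds (show 0 < Γ * τ * (η / 2) by positivity))).and
    (eventually_ge_atTop τ)
  obtain ⟨T, hT⟩ := eventually_atTop.1 h2
  refine ⟨T, fun t ht => ?_⟩
  obtain ⟨h3, h4⟩ := hT t ht.le
  have h5 := (key τ hτ t h4).trans_lt h3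
  have h6 : h t - M * τ < η / 2 := lt_of_mul_lt_mul_left h5 (by positivity)
  have h7 : M * τ = η / 2 := by rw [hτd]; field_simp
  rw [Real.dist_eq, sub_zero, abs_of_nonneg (h0 t)]
  linarith

end DADS

/-! ### Continuous representatives and integration by parts in H¹(0,1). -/

namespace DADS

theorem integral_unitMeasure (f : ℝ → ℝ) : ∫ x, f x ∂unitMeasure = ∫ x in (0 : ℝ)..1, f x := by
  rw [intervalIntegral.integral_of_le zero_le_one, integral_Ioc_eq_integral_Ioo]

theorem intervalIntegrable_of_integrable_unitMeasure {f : ℝ → ℝ} (hf : Integrable f unitMeasure) :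
    IntervalIntegrable f volume 0 1 := by
  rw [intervalIntegrable_iff_integrableOn_Ioo_of_le zero_le_one]
  exact hf

theorem integrable_L2 (f : L2) : Integrable f unitMeasure :=
  (Lp.memLp f).integrable one_le_two

/-- A continuous function of mean zero, compactly supported in `(0,1)`, is the derivative of a
`C¹` function compactly supported in `(0,1)`. -/
theorem exists_primitive_compactSupport {h : ℝ → ℝ} (hc : Continuous h)
    (hs : HasCompactSupport h) (ht : tsupport h ⊆ Ioo (0 : ℝ) 1)
    (h0 : ∫ x in (0 : ℝ)..1, h x = 0) :
    ∃ ψ : ℝ → ℝ, ContDiff ℝ 1 ψ ∧ HasCompactSupport ψ ∧ tsupport ψ ⊆ Ioo (0 : ℝ) 1 ∧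
      deriv ψ = h := by
  obtain ⟨α, β, hα, hβ, hsub⟩ : ∃ α β : ℝ, 0 < α ∧ β < 1 ∧ tsupport h ⊆ Icc α β := by
    rcases (tsupport h).eq_empty_or_nonempty with he | hne
    · exact ⟨1 / 2, 1 / 2, by norm_num, by norm_num, by simp [he]⟩
    · have hK : IsCompact (tsupport h) := hs
      obtain ⟨α, hα⟩ := hK.exists_isLeast hne
      obtain ⟨β, hβ⟩ := hK.exists_isGreatest hne
      exact ⟨α, β, (ht hα.1).1, (ht hβ.1).2, fun x hx => ⟨hα.2 hx, hβ.2 hx⟩⟩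
  have hz : ∀ x, x ∉ Icc α β → h x = 0 := fun x hx =>
    image_eq_zero_of_notMem_tsupport fun hx' => hx (hsub hx')
  have hd : ∀ x, HasDerivAt (fun x => ∫ t in (0 : ℝ)..x, h t) (h x) x := fun x =>
    intervalIntegral.integral_hasDerivAt_right (hc.intervalIntegrable _ _)
      (hc.stronglyMeasurableAtFilter _ _) hc.continuousAt
  have hderiv : deriv (fun x => ∫ t in (0 : ℝ)..x, h t) = h := funext fun x => (hd x).deriv
  -- Left of α the integrand vanishes; right of β the primitive equals the total integral, which is
  -- 0.
  have hsupp : Function.support (fun x => ∫ t in (0 : ℝ)..x, h t) ⊆ Icc α β := by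
    intro x hx
    by_contra hn
    refine hx ?_
    rw [mem_Icc, not_and_or, not_le, not_le] at hn
    rcases hn with hn | hn
    · refine intervalIntegral.integral_zero_ae (Eventually.of_forall fun t ht => ?_)
      refine hz t fun hm => ?_
      have h1 := ht.2
      have h2 := max_lt hα hn
      linarith [hm.1]
    · have h2 : ∫ t in x..1, h t = 0 := by
        refine intervalIntegral.integral_zero_ae (Eventually.of_forall fun t ht => ?_)
        refine hz t fun hm => ?_
        have h1 := ht.1
        have h2 := lt_min hn hβ
        linarith [hm.2]
      have h3 := intervalIntegral.integral_add_adjacent_intervals (hc.intervalIntegrable 0 x)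
        (hc.intervalIntegrable (μ := volume) x 1)
      rw [h2, add_zero, h0] at h3
      exact h3
  have hts : tsupport (fun x => ∫ t in (0 : ℝ)..x, h t) ⊆ Icc α β :=
    closure_minimal hsupp isClosed_Icc
  refine ⟨fun x => ∫ t in (0 : ℝ)..x, h t, ?_, ?_, ?_, hderiv⟩
  · rw [contDiff_one_iff_deriv, hderiv]
    exact ⟨fun x => (hd x).differentiableAt, hc⟩
  · exact isCompact_Icc.of_isClosed_subset (isClosed_tsupport _) hts
  · exact hts.trans (Icc_subset_Ioo hα hβ)

/-- The du Bois-Reymond lemma on `(0,1)`. -/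
theorem ae_eq_const_of_integral_mul_deriv_eq_zero {H : ℝ → ℝ} (hH : Integrable H unitMeasure)
    (h : ∀ ψ : ℝ → ℝ, ContDiff ℝ 1 ψ → HasCompactSupport ψ → tsupport ψ ⊆ Ioo (0 : ℝ) 1 →
      ∫ x, H x * deriv ψ x ∂unitMeasure = 0) :
    ∃ m : ℝ, ∀ᵐ x, x ∈ Ioo (0 : ℝ) 1 → H x = m := by
  -- A bump of mass 1: subtracting a multiple of it gives any test function mean zero, hence makes
  -- it a derivative. The constant is then ∫ H χ.
  obtain ⟨χ, hχ⟩ : ∃ χ : ℝ → ℝ, ContDiff ℝ 1 χ ∧ HasCompactSupport χ ∧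
      tsupport χ ⊆ Ioo (0 : ℝ) 1 ∧ ∫ x in (0 : ℝ)..1, χ x = 1 := by
    obtain ⟨f, h1, h2, h3, h4, h5⟩ := exists_contDiff_tsupport_subset (n := 1)
      (isOpen_Ioo.mem_nhds (show (1 / 2 : ℝ) ∈ Ioo (0 : ℝ) 1 by constructor <;> norm_num))
    have hpos : 0 < ∫ x in (0 : ℝ)..1, f x := by
      refine intervalIntegral.integral_pos zero_lt_one h3.continuous.continuousOn
        (fun x _ => (h4 (mem_range_self x)).1) ⟨1 / 2, by constructor <;> norm_num, ?_⟩
      rw [h5]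
      exact one_pos
    refine ⟨fun x => (∫ x in (0 : ℝ)..1, f x)⁻¹ * f x, contDiff_const.mul h3, h2.mul_left,
      (tsupport_mul_subset_right).trans h1, ?_⟩
    rw [intervalIntegral.integral_const_mul, inv_mul_cancel₀ hpos.ne']
  obtain ⟨hχ1, hχ2, hχ3, hχ4⟩ := hχ
  have hint : ∀ g : ℝ → ℝ, Continuous g → HasCompactSupport g →
      Integrable (fun x => H x * g x) unitMeasure := by
    intro g hg hgs
    obtain ⟨M, hM⟩ := hgs.exists_bound_of_continuous hg
    exact hH.mul_bdd (c := M) hg.aestronglyMeasurable (Eventually.of_forall hM)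
  refine ⟨∫ x, H x * χ x ∂unitMeasure, ?_⟩
  set m := ∫ x, H x * χ x ∂unitMeasure with hm
  have key := isOpen_Ioo.ae_eq_zero_of_integral_contDiff_smul_eq_zero (μ := volume)
    (f := fun x => H x - m) (U := Ioo (0 : ℝ) 1) ?_ ?_
  · filter_upwards [key] with x hx hmem
    linarith [hx hmem]
  · have h1 : IntegrableOn (fun x => H x - m) (Ioo (0 : ℝ) 1) volume :=
      Integrable.sub hH (integrable_const m)
    exact h1.locallyIntegrableOn
  · intro g hg hgs hgt
    have hgc := hg.continuous
    set c := ∫ x in (0 : ℝ)..1, g x with hc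
    have hs1 : tsupport (fun x => c * χ x) ⊆ tsupport χ := tsupport_mul_subset_right
    obtain ⟨ψ, hψ1, hψ2, hψ3, hψ4⟩ := exists_primitive_compactSupport
      (h := fun x => g x - c * χ x) (hgc.sub (hχ1.continuous.const_mul c))
      (hgs.sub hχ2.mul_left)
      ((tsupport_sub _ _).trans (union_subset hgt (hs1.trans hχ3)))
      (by
        rw [intervalIntegral.integral_sub (hgc.intervalIntegrable _ _)
          ((hχ1.continuous.const_mul c).intervalIntegrable _ _),
          intervalIntegral.integral_const_mul, hχ4, mul_one, sub_self])
    have h1 := h ψ hψ1 hψ2 hψ3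
    rw [hψ4] at h1
    have h2 : ∀ x, H x * (g x - c * χ x) = H x * g x - c * (H x * χ x) := fun x => by ring
    simp only [h2] at h1
    rw [integral_sub (hint g hgc hgs) ((hint χ hχ1.continuous hχ2).const_mul c),
      integral_const_mul, ← hm] at h1
    have h3 : ∫ x, g x • (H x - m) = ∫ x, (H x * g x - m * g x) ∂unitMeasure := by
      rw [← setIntegral_eq_integral_of_forall_compl_eq_zero (s := Ioo (0 : ℝ) 1)]
      · refine integral_congr_ae (Eventually.of_forall fun x => ?_)
        simp only [smul_eq_mul]
        ring
      · intro x hx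
        rw [image_eq_zero_of_notMem_tsupport (fun hx' => hx (hgt hx')), zero_smul]
    have h4 : Integrable g unitMeasure := (hgc.integrable_of_hasCompactSupport hgs).restrict
    rw [h3, integral_sub (hint g hgc hgs) (h4.const_mul m), integral_const_mul,
      integral_unitMeasure g, ← hc]
    linarith

theorem eq_zero_of_tsupport_subset {ψ : ℝ → ℝ} (h : tsupport ψ ⊆ Ioo (0 : ℝ) 1) :
    ψ 0 = 0 ∧ ψ 1 = 0 :=
  ⟨image_eq_zero_of_notMem_tsupport fun h' => lt_irrefl _ (h h').1,
    image_eq_zero_of_notMem_tsupport fun h' => lt_irrefl _ (h h').2⟩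

/-- The continuous representative of an element of `H¹(0,1)` is a primitive of its weak
derivative. -/
theorem H1.eq_add_integral (f : H1) {F : ℝ → ℝ} (hF : ContinuousOn F (Icc 0 1))
    (hfF : (f.toL2 : ℝ → ℝ) =ᵐ[unitMeasure] F) {x : ℝ} (hx : x ∈ Icc (0 : ℝ) 1) :
    F x = F 0 + ∫ t in (0 : ℝ)..x, f.dx t := by
  have hgi := intervalIntegrable_of_integrable_unitMeasure (integrable_L2 f.dx)
  have hA : AbsolutelyContinuousOnInterval (fun x => ∫ t in (0 : ℝ)..x, f.dx t) 0 1 :=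
    hgi.absolutelyContinuousOnInterval_intervalIntegral left_mem_uIcc
  have hAc : ContinuousOn (fun x => ∫ t in (0 : ℝ)..x, f.dx t) (Icc 0 1) := by
    have := hA.continuousOn
    rwa [uIcc_of_le zero_le_one] at this
  have hFi : Integrable F unitMeasure := (integrable_L2 f.toL2).congr hfF
  have hAi : Integrable (fun x => ∫ t in (0 : ℝ)..x, f.dx t) unitMeasure :=
    hAc.integrableOn_Icc.mono_set Ioo_subset_Icc_self
  -- F and the primitive of the weak derivative have the same weak derivative, so du Bois-Reymond
  -- applies to their difference.
  obtain ⟨m, hm⟩ := ae_eq_const_of_integral_mul_deriv_eq_zero (hFi.sub hAi) (by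
    intro ψ h1 h2 h3
    have hψ' : Continuous (deriv ψ) := h1.continuous_deriv le_rfl
    have hb : ∀ g : ℝ → ℝ, Integrable g unitMeasure →
        Integrable (fun x => g x * deriv ψ x) unitMeasure := by
      intro g hg
      obtain ⟨M, hM⟩ := h2.deriv.exists_bound_of_continuous hψ'
      exact hg.mul_bdd (c := M) hψ'.aestronglyMeasurable (Eventually.of_forall hM)
    have e1 : ∫ x, F x * deriv ψ x ∂unitMeasure = -∫ x, f.dx x * ψ x ∂unitMeasure := by
      have h4 : ∫ x, f.toL2 x * deriv ψ x ∂unitMeasure = -∫ x, f.dx x * ψ x ∂unitMeasure :=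
        f.2 ψ h1 h2 h3
      rw [← h4]
      refine integral_congr_ae ?_
      filter_upwards [hfF] with x hx
      rw [hx]
    have e2 : ∫ x, (∫ t in (0 : ℝ)..x, f.dx t) * deriv ψ x ∂unitMeasure
        = -∫ x, f.dx x * ψ x ∂unitMeasure := by
      rw [integral_unitMeasure, integral_unitMeasure, hA.integral_mul_deriv_eq_deriv_mul
        (h1.contDiffOn.absolutelyContinuousOnInterval), (eq_zero_of_tsupport_subset h3).1,
        (eq_zero_of_tsupport_subset h3).2, mul_zero, mul_zero, sub_zero, zero_sub]
      congr 1
      refine intervalIntegral.integral_congr_ae ?_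
      filter_upwards [hgi.ae_hasDerivAt_integral] with x hx hmem
      rw [(hx (uIoc_subset_uIcc hmem) 0 left_mem_uIcc).deriv]
    have e3 : ∀ x, (F - fun x => ∫ t in (0 : ℝ)..x, f.dx t) x * deriv ψ x =
        F x * deriv ψ x - (∫ t in (0 : ℝ)..x, f.dx t) * deriv ψ x := fun x => by
      rw [Pi.sub_apply, sub_mul]
    simp only [e3]
    rw [integral_sub (hb F hFi) (hb _ hAi), e1, e2, sub_self])
  have hcont : ContinuousOn (fun x => F x - ∫ t in (0 : ℝ)..x, f.dx t) (Icc 0 1) := hF.sub hAc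
  -- Continuity upgrades the a.e. equality to all of [0,1], including the endpoint 0 where the
  -- boundary value is read off.
  have heq : EqOn (fun x => F x - ∫ t in (0 : ℝ)..x, f.dx t) (fun _ => m) (Icc 0 1) := by
    refine MeasureTheory.Measure.eqOn_Icc_of_ae_eq volume zero_ne_one ?_ hcont continuousOn_const
    rw [EventuallyEq, ← restrict_Ioo_eq_restrict_Icc, ae_restrict_iff' measurableSet_Ioo]
    exact hm
  have h1 := heq hx
  have h2 := heq (left_mem_Icc.2 zero_le_one)
  simp only [intervalIntegral.integral_same, sub_zero] at h1 h2
  linarith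

/-- Integration by parts of `∫ e^{-x} f f'` for `f ∈ H¹(0,1)`, the nonnegative boundary term at
`x = 1` being dropped. -/
theorem H1.le_integral_exp_mul_dx (f : H1) {v : ℝ} (hv : f.HasValueAtZero v) :
    (∫ x, Real.exp (-x) * f.toL2 x ^ 2 ∂unitMeasure) - v ^ 2
      ≤ 2 * ∫ x, Real.exp (-x) * (f.toL2 x * f.dx x) ∂unitMeasure := by
  obtain ⟨F, hF, hfF, rfl⟩ := hv
  have hgi := intervalIntegrable_of_integrable_unitMeasure (integrable_L2 f.dx)
  -- An absolutely continuous representative, so that the product rule and the fundamental theorem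
  -- of calculus apply to e^{-x} A².
  set A : ℝ → ℝ := fun x => F 0 + ∫ t in (0 : ℝ)..x, f.dx t with hAd
  have hA : AbsolutelyContinuousOnInterval A 0 1 :=
    (AbsolutelyContinuousOnInterval.const 0 1 (F 0)).add
      (hgi.absolutelyContinuousOnInterval_intervalIntegral left_mem_uIcc)
  have hE : AbsolutelyContinuousOnInterval (fun x => Real.exp (-x)) 0 1 :=
    ContDiffOn.absolutelyContinuousOnInterval (by fun_prop)
  have hfA : (f.toL2 : ℝ → ℝ) =ᵐ[unitMeasure] A := by
    filter_upwards [hfF, ae_restrict_mem measurableSet_Ioo] with x hx hmem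
    rw [hx, f.eq_add_integral hF hfF (Ioo_subset_Icc_self hmem)]
  have hint := (hE.mul (hA.mul hA)).integral_deriv_eq_sub
  have hA0 : A 0 = F 0 := by simp [hAd]
  simp only [Pi.mul_apply, neg_zero, Real.exp_zero, one_mul, hA0] at hint
  have hsplit : ∫ x in (0 : ℝ)..1, deriv ((fun x => Real.exp (-x)) * (A * A)) x =
      ∫ x, (2 * (Real.exp (-x) * (f.toL2 x * f.dx x)) - Real.exp (-x) * f.toL2 x ^ 2)
        ∂unitMeasure := by
    rw [← integral_unitMeasure]
    refine integral_congr_ae ?_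
    filter_upwards [hfA, ae_restrict_of_ae hgi.ae_hasDerivAt_integral,
      ae_restrict_mem measurableSet_Ioo] with x hx hd hmem
    have hx1 : x ∈ uIcc (0 : ℝ) 1 := by
      rw [uIcc_of_le zero_le_one]
      exact Ioo_subset_Icc_self hmem
    have h1 : HasDerivAt A (f.dx x) x := (hd hx1 0 left_mem_uIcc).const_add (F 0)
    have h2 : HasDerivAt (fun x => Real.exp (-x)) (Real.exp (-x) * -1) x :=
      (hasDerivAt_id x).neg.exp
    have h3 := (h2.mul (h1.mul h1)).deriv
    rw [h3, hx]
    simp only [Pi.mul_apply]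
    ring
  have hbd : ∀ g : ℝ → ℝ, Integrable g unitMeasure →
      Integrable (fun x => Real.exp (-x) * g x) unitMeasure := by
    intro g hg
    refine hg.bdd_mul (c := 1) (by fun_prop) ?_
    filter_upwards [ae_restrict_mem measurableSet_Ioo] with x hx
    rw [Real.norm_eq_abs, Real.abs_exp, Real.exp_le_one_iff]
    linarith [hx.1]
  have hi1 : Integrable (fun x => f.toL2 x * f.dx x) unitMeasure :=
    (Lp.memLp f.toL2).integrable_mul (Lp.memLp f.dx)
  have hi2 : Integrable (fun x => f.toL2 x ^ 2) unitMeasure := (Lp.memLp f.toL2).integrable_sq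
  rw [hsplit, integral_sub ((hbd _ hi1).const_mul 2) (hbd _ hi2), integral_const_mul] at hint
  have hpos : 0 ≤ Real.exp (-1) * (A 1 * A 1) :=
    mul_nonneg (Real.exp_pos _).le (mul_self_nonneg _)
  nlinarith

end DADS

/-! ### The weighted norm Φ and its dissipation by transport. -/

noncomputable section

namespace DADS

theorem norm_exp_mul_le (f : L2) :
    ∀ᵐ x ∂unitMeasure, ‖Real.exp (-x / 2) * f x‖ ≤ ‖f x‖ := by
  filter_upwards [ae_restrict_mem measurableSet_Ioo] with x hx
  rw [norm_mul, Real.norm_eq_abs, Real.abs_exp]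
  refine mul_le_of_le_one_left (norm_nonneg _) ?_
  rw [Real.exp_le_one_iff]
  linarith [hx.1]

theorem memLp_exp_mul (f : L2) : MemLp (fun x => Real.exp (-x / 2) * f x) 2 unitMeasure := by
  have h : AEStronglyMeasurable (fun x : ℝ => Real.exp (-x / 2)) unitMeasure := by fun_prop
  exact (Lp.memLp f).of_le (h.mul (Lp.memLp f).1) (norm_exp_mul_le f)

/-- Multiplication by `exp (-x/2)` on `L²(0,1)`. -/
def expMul : L2 →L[ℝ] L2 :=
  LinearMap.mkContinuous
    { toFun := fun f => (memLp_exp_mul f).toLp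
      map_add' := by
        intro f g
        rw [← MemLp.toLp_add (memLp_exp_mul f) (memLp_exp_mul g)]
        refine MemLp.toLp_congr _ _ ?_
        filter_upwards [Lp.coeFn_add f g] with x hx
        simp only [hx, Pi.add_apply]
        ring
      map_smul' := by
        intro r f
        rw [RingHom.id_apply, ← MemLp.toLp_const_smul r (memLp_exp_mul f)]
        refine MemLp.toLp_congr _ _ ?_
        filter_upwards [Lp.coeFn_smul r f] with x hx
        simp only [hx, Pi.smul_apply, smul_eq_mul]
        ring } 1
    (by
      intro f
      rw [one_mul]
      refine Lp.norm_le_norm_of_ae_le ?_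
      filter_upwards [(memLp_exp_mul f).coeFn_toLp, norm_exp_mul_le f] with x hx h
      change ‖((memLp_exp_mul f).toLp _ : L2) x‖ ≤ _
      rw [hx]
      exact h)

theorem coeFn_expMul (f : L2) : expMul f =ᵐ[unitMeasure] fun x => Real.exp (-x / 2) * f x :=
  (memLp_exp_mul f).coeFn_toLp

theorem norm_expMul_le (f : L2) : ‖expMul f‖ ≤ ‖f‖ := by
  refine Lp.norm_le_norm_of_ae_le ?_
  filter_upwards [coeFn_expMul f, norm_exp_mul_le f] with x hx h
  rw [hx]
  exact h

theorem inner_expMul (f g : L2) :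
    inner ℝ (expMul f) (expMul g) = ∫ x, Real.exp (-x) * (f x * g x) ∂unitMeasure := by
  rw [L2.inner_def]
  refine integral_congr_ae ?_
  filter_upwards [coeFn_expMul f, coeFn_expMul g] with x hf hg
  have h : Real.exp (-x) = Real.exp (-x / 2) * Real.exp (-x / 2) := by
    rw [← Real.exp_add]
    ring_nf
  simp only [hf, hg, RCLike.inner_apply, conj_trivial]
  rw [h]
  ring

theorem norm_expMul_sq (f : L2) :
    ‖expMul f‖ ^ 2 = ∫ x, Real.exp (-x) * f x ^ 2 ∂unitMeasure := by
  rw [← real_inner_self_eq_norm_sq, inner_expMul]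
  simp only [sq]

/-- On (0,1) one has e^{1/2} e^{-x/2} ≥ 1; this is the source of the ratio e between the two
constants bounding Φ. -/
theorem norm_sq_le_norm_expMul_sq (f : L2) : ‖f‖ ^ 2 ≤ Real.exp 1 * ‖expMul f‖ ^ 2 := by
  have h : ‖f‖ ≤ ‖Real.exp (1 / 2) • expMul f‖ := by
    refine Lp.norm_le_norm_of_ae_le ?_
    filter_upwards [coeFn_expMul f, Lp.coeFn_smul (Real.exp (1 / 2)) (expMul f),
      ae_restrict_mem measurableSet_Ioo] with x h1 h2 hx
    rw [h2, Pi.smul_apply, h1, smul_eq_mul, ← mul_assoc, ← Real.exp_add, norm_mul,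
      Real.norm_eq_abs (Real.exp _), Real.abs_exp]
    refine le_mul_of_one_le_left (norm_nonneg _) (Real.one_le_exp ?_)
    linarith [hx.2]
  rw [norm_smul, Real.norm_eq_abs, Real.abs_exp] at h
  calc ‖f‖ ^ 2 ≤ (Real.exp (1 / 2) * ‖expMul f‖) ^ 2 := pow_le_pow_left₀ (norm_nonneg _) h 2
    _ = Real.exp 1 * ‖expMul f‖ ^ 2 := by
      rw [mul_pow, ← Real.exp_nat_mul]
      norm_num

theorem Phi_eq (c : ℝ) (f : L2) : Phi c f = 2 * Real.exp 1 / c * ‖expMul f‖ ^ 2 := by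
  rw [norm_expMul_sq, Phi]

theorem lowerConst_mul_le_Phi {c : ℝ} (hc : 0 < c) (f : L2) :
    lowerConst c * ‖f‖ ^ 2 ≤ Phi c f := by
  rw [Phi_eq, lowerConst]
  calc 2 / c * ‖f‖ ^ 2 ≤ 2 / c * (Real.exp 1 * ‖expMul f‖ ^ 2) := by
        gcongr
        exact norm_sq_le_norm_expMul_sq f
    _ = _ := by ring

theorem Phi_le_upperConst_mul {c : ℝ} (hc : 0 < c) (f : L2) :
    Phi c f ≤ upperConst c * ‖f‖ ^ 2 := by
  rw [Phi_eq, upperConst]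
  gcongr
  exact norm_expMul_le f

/-- Φ is a squared Hilbert norm after the bounded linear map `expMul`, so differentiability of w in
L² suffices. -/
theorem hasDerivAt_Phi (c : ℝ) {w : ℝ → L2} {wt : L2} {t : ℝ} (h : HasDerivAt w wt t) :
    HasDerivAt (fun s => Phi c (w s))
      (2 * Real.exp 1 / c * (2 * inner ℝ (expMul (w t)) (expMul wt))) t := by
  simp only [Phi_eq]
  exact (expMul.hasFDerivAt.comp_hasDerivAt t h).norm_sq.const_mul _

/-- The dissipation inequality of the transport equation for the functional `Φ`. -/
theorem transport_dissipation {c : ℝ} (hc : 0 < c) (W : H1) {wt θ₁₁ δ : L2} {K : ℝ → ℝ}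
    {v θ₁₂ y : ℝ} (hv : W.HasValueAtZero v) (hvy : |v| ≤ |θ₁₂| * |y|)
    (hpde : ∀ᵐ x ∂unitMeasure, wt x + c * W.dx x = θ₁₁ x * K x + δ x)
    (hK : ∀ x ∈ Icc (0 : ℝ) 1, |K x| ≤ |y|) :
    2 * Real.exp 1 / c * (2 * inner ℝ (expMul W.toL2) (expMul wt))
      ≤ -‖W.toL2‖ ^ 2 + (R * paramNorm c θ₁₁ θ₁₂) ^ 2 * y ^ 2 + G c * ‖δ‖ ^ 2 := by
  set e := Real.exp 1 with he
  have he0 : 0 < e := Real.exp_pos 1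
  have he1 : 1 ≤ e := Real.one_le_exp zero_le_one
  -- The right-hand side of the equation; w_t = f - c w_x separates a term for Cauchy-Schwarz from
  -- one for integration by parts.
  set f : L2 := wt + c • W.dx with hf
  have hfn : ‖f - δ‖ ≤ |y| * ‖θ₁₁‖ := by
    have h1 : ‖f - δ‖ ≤ ‖y • θ₁₁‖ := by
      refine Lp.norm_le_norm_of_ae_le ?_
      filter_upwards [hpde, Lp.coeFn_sub f δ, Lp.coeFn_add wt (c • W.dx), Lp.coeFn_smul c W.dx,
        Lp.coeFn_smul y θ₁₁, ae_restrict_mem measurableSet_Ioo] with x h1 h2 h3 h4 h5 hx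
      rw [h2, h5, Pi.sub_apply, hf, h3, Pi.add_apply, h4, Pi.smul_apply, Pi.smul_apply,
        smul_eq_mul, smul_eq_mul, h1, add_sub_cancel_right, norm_mul, norm_mul, mul_comm]
      exact mul_le_mul_of_nonneg_right (hK x (Ioo_subset_Icc_self hx)) (norm_nonneg _)
    rwa [norm_smul] at h1
  have hf2 : ‖f‖ ^ 2 ≤ 2 * (‖θ₁₁‖ ^ 2 * y ^ 2) + 2 * ‖δ‖ ^ 2 := by
    have h1 : ‖f‖ ≤ |y| * ‖θ₁₁‖ + ‖δ‖ := by
      calc ‖f‖ = ‖(f - δ) + δ‖ := by rw [sub_add_cancel]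
        _ ≤ _ := (norm_add_le _ _).trans (by gcongr)
    have h2 : ‖f‖ ^ 2 ≤ (|y| * ‖θ₁₁‖ + ‖δ‖) ^ 2 := pow_le_pow_left₀ (norm_nonneg _) h1 2
    have h3 : (|y| * ‖θ₁₁‖) ^ 2 = ‖θ₁₁‖ ^ 2 * y ^ 2 := by rw [mul_pow, sq_abs, mul_comm]
    nlinarith [sq_nonneg (|y| * ‖θ₁₁‖ - ‖δ‖)]
  have hv2 : v ^ 2 ≤ θ₁₂ ^ 2 * y ^ 2 := by
    rw [← sq_abs v, ← sq_abs θ₁₂, ← sq_abs y, ← mul_pow]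
    exact pow_le_pow_left₀ (abs_nonneg _) hvy 2
  have hibp := W.le_integral_exp_mul_dx hv
  rw [← norm_expMul_sq, ← inner_expMul] at hibp
  set M := expMul W.toL2 with hM
  have hwt : expMul wt = expMul f - c • expMul W.dx := by
    rw [hf, map_add, map_smul, add_sub_cancel_right]
  have hin : inner ℝ M (expMul wt) = inner ℝ M (expMul f) - c * inner ℝ M (expMul W.dx) := by
    rw [hwt, inner_sub_right, inner_smul_right]
  -- Integration by parts supplies -2e‖M‖². Half of it is spent here, and the rest dominates ‖w‖².
  have hcs : 4 * e / c * inner ℝ M (expMul f) ≤ e * ‖M‖ ^ 2 + 4 * e / c ^ 2 * ‖f‖ ^ 2 := by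
    have h1 : inner ℝ M (expMul f) ≤ ‖M‖ * ‖f‖ :=
      (real_inner_le_norm _ _).trans (by gcongr; exact norm_expMul_le f)
    have h2 : 0 ≤ e * (‖M‖ - 2 / c * ‖f‖) ^ 2 := by positivity
    have h3 : e * (‖M‖ - 2 / c * ‖f‖) ^ 2 =
        e * ‖M‖ ^ 2 + 4 * e / c ^ 2 * ‖f‖ ^ 2 - 4 * e / c * (‖M‖ * ‖f‖) := by
      field_simp
      ring
    have h4 : 4 * e / c * inner ℝ M (expMul f) ≤ 4 * e / c * (‖M‖ * ‖f‖) := by gcongr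
    linarith
  have hexp : 2 * e / c * (2 * inner ℝ M (expMul wt)) =
      4 * e / c * inner ℝ M (expMul f) - 2 * e * (2 * inner ℝ M (expMul W.dx)) := by
    rw [hin]
    field_simp
    ring
  have hR : (R * paramNorm c θ₁₁ θ₁₂) ^ 2 =
      2 * e * θ₁₂ ^ 2 + 8 * e ^ 2 / c ^ 2 * ‖θ₁₁‖ ^ 2 := by
    rw [mul_pow, R, paramNorm, Real.sq_sqrt (by positivity), Real.sq_sqrt (by positivity), ← he]
    ring
  have hlow := norm_sq_le_norm_expMul_sq W.toL2
  rw [← hM, ← he] at hlow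
  -- A factor e ≥ 1 is given away to reach the coefficients in R and G.
  have hfin : 4 * e / c ^ 2 * ‖f‖ ^ 2 ≤
      8 * e ^ 2 / c ^ 2 * ‖θ₁₁‖ ^ 2 * y ^ 2 + 8 * e ^ 2 / c ^ 2 * ‖δ‖ ^ 2 := by
    have h8 : 8 * e / c ^ 2 ≤ 8 * e ^ 2 / c ^ 2 := by
      gcongr
      nlinarith
    calc 4 * e / c ^ 2 * ‖f‖ ^ 2 ≤ 4 * e / c ^ 2 * (2 * (‖θ₁₁‖ ^ 2 * y ^ 2) + 2 * ‖δ‖ ^ 2) := by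
          gcongr
      _ = 8 * e / c ^ 2 * (‖θ₁₁‖ ^ 2 * y ^ 2 + ‖δ‖ ^ 2) := by ring
      _ ≤ 8 * e ^ 2 / c ^ 2 * (‖θ₁₁‖ ^ 2 * y ^ 2 + ‖δ‖ ^ 2) := by gcongr
      _ = _ := by ring
  have hb1 := mul_le_mul_of_nonneg_left hibp (show 0 ≤ 2 * e by positivity)
  have hb2 := mul_le_mul_of_nonneg_left hv2 (show 0 ≤ 2 * e by positivity)
  rw [hexp, hR, G, ← he]
  linarith

end DADS

end

/-! ### Pointwise inequalities for the feedback. -/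

namespace DADS

/-- The damping provided by the high-gain feedback when the control coefficient is at least `β`,
up to an error that vanishes for `1 / β ≤ q`. -/
theorem damping_lower_bound {κ a q b β lam M₀ M₁ N₀ N₁ p₁ p₂ p₃ y : ℝ} (hκ : 0 < κ)
    (ha : 0 < a) (hq : κ ≤ q) (hβ : 0 < β) (hb : β ≤ b) (hlam : 0 < lam)
    (hN₀ : 0 ≤ N₀) (hN₁ : 0 ≤ N₁) (h₀ : N₀ ≤ (q / κ) ^ 3 * M₀) (h₁ : N₁ ≤ (q / κ) ^ 3 * M₁)
    (hp₁ : M₀ ≤ κ ^ 6 * p₁) (hp₂ : M₁ + M₀ ^ 2 / (lam * a) ≤ κ ^ 6 * p₂)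
    (hp₃ : M₁ ^ 2 / (lam * a) ≤ κ ^ 6 * p₃) :
    N₀ * y ^ 2 + N₁ * y ^ 4 - a / q * (lam / 2 * β * max (1 / β - q) 0 ^ 2)
      ≤ b * (q ^ 7 * (p₁ + p₂ * y ^ 2 + p₃ * y ^ 6) * y ^ 2) := by
  set p := q / κ with hp
  have hq0 : 0 < q := hκ.trans_le hq
  have hqp : q = κ * p := by rw [hp]; field_simp
  have hp1 : 1 ≤ p := by rw [hp, le_div_iff₀ hκ]; linarith
  have hp3 : 0 < p ^ 3 := by positivity
  have hM₀ : 0 ≤ M₀ := nonneg_of_mul_nonneg_right (hN₀.trans h₀) hp3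
  have hM₁ : 0 ≤ M₁ := nonneg_of_mul_nonneg_right (hN₁.trans h₁) hp3
  have hla : 0 < lam * a := by positivity
  have hpp : p ^ 3 ≤ p ^ 6 := pow_le_pow_right₀ hp1 (by norm_num)
  have e6 : q ^ 6 = p ^ 6 * κ ^ 6 := by rw [hqp]; ring
  have sq_le : ∀ {M N : ℝ}, 0 ≤ N → N ≤ p ^ 3 * M → N ^ 2 ≤ p ^ 6 * M ^ 2 := by
    intro M N hN h
    calc N ^ 2 ≤ (p ^ 3 * M) ^ 2 := pow_le_pow_left₀ hN h 2
      _ = p ^ 6 * M ^ 2 := by ring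
  have g₁ : N₀ ≤ q ^ 6 * p₁ := by
    calc N₀ ≤ p ^ 6 * M₀ := h₀.trans (mul_le_mul_of_nonneg_right hpp hM₀)
      _ ≤ p ^ 6 * (κ ^ 6 * p₁) := by gcongr
      _ = q ^ 6 * p₁ := by rw [e6]; ring
  have g₂ : N₁ + N₀ ^ 2 / (lam * a) ≤ q ^ 6 * p₂ := by
    calc N₁ + N₀ ^ 2 / (lam * a) ≤ p ^ 6 * M₁ + p ^ 6 * M₀ ^ 2 / (lam * a) :=
          add_le_add (h₁.trans (mul_le_mul_of_nonneg_right hpp hM₁))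
            (div_le_div_of_nonneg_right (sq_le hN₀ h₀) hla.le)
      _ = p ^ 6 * (M₁ + M₀ ^ 2 / (lam * a)) := by ring
      _ ≤ p ^ 6 * (κ ^ 6 * p₂) := by gcongr
      _ = q ^ 6 * p₂ := by rw [e6]; ring
  have g₃ : N₁ ^ 2 / (lam * a) ≤ q ^ 6 * p₃ := by
    calc N₁ ^ 2 / (lam * a) ≤ p ^ 6 * M₁ ^ 2 / (lam * a) :=
          div_le_div_of_nonneg_right (sq_le hN₁ h₁) hla.le
      _ = p ^ 6 * (M₁ ^ 2 / (lam * a)) := by ring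
      _ ≤ p ^ 6 * (κ ^ 6 * p₃) := by gcongr
      _ = q ^ 6 * p₃ := by rw [e6]; ring
  -- The shortfall of q relative to 1/β: the effective gain βq is only guaranteed to be at least 1 -
  -- βs.
  set s := max (1 / β - q) 0 with hs
  have hs0 : 0 ≤ s := le_max_right _ _
  have hβs : 1 - β * s ≤ β * q := by
    have h := le_max_left (1 / β - q) 0
    rw [← hs] at h
    have h2 := mul_le_mul_of_nonneg_left h hβ.le
    have h3 : β * (1 / β - q) = 1 - β * q := by field_simp
    linarith
  set Y := N₀ * y ^ 2 + N₁ * y ^ 4 with hY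
  -- The quadratic surplus in p₂ and p₃, reserved to pay for the deficit βsY.
  set Q := (N₀ * y ^ 2) ^ 2 / (lam * a) + (N₁ * y ^ 4) ^ 2 / (lam * a) with hQ
  have hY0 : 0 ≤ Y := by positivity
  have hQ0 : 0 ≤ Q := by positivity
  have hX : Y + Q ≤ q ^ 6 * (p₁ + p₂ * y ^ 2 + p₃ * y ^ 6) * y ^ 2 := by
    have k₁ := mul_le_mul_of_nonneg_right g₁ (sq_nonneg y)
    have k₂ := mul_le_mul_of_nonneg_right g₂ (show 0 ≤ y ^ 4 by positivity)
    have k₃ := mul_le_mul_of_nonneg_right g₃ (show 0 ≤ y ^ 8 by positivity)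
    calc Y + Q = N₀ * y ^ 2 + (N₁ + N₀ ^ 2 / (lam * a)) * y ^ 4 +
          N₁ ^ 2 / (lam * a) * y ^ 8 := by rw [hY, hQ]; ring
      _ ≤ q ^ 6 * p₁ * y ^ 2 + q ^ 6 * p₂ * y ^ 4 + q ^ 6 * p₃ * y ^ 8 := by linarith
      _ = _ := by ring
  -- Weighted so that the error carries a/q; its two uses add up to lam/2.
  have young : ∀ N : ℝ, β * s * N ≤ β * q * (N ^ 2 / (lam * a)) + a / q * (lam / 4 * β * s ^ 2) := by
    intro N
    have h : 0 ≤ β * q / (lam * a) * (N - lam * a / (2 * q) * s) ^ 2 := by positivity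
    have e : β * q / (lam * a) * (N - lam * a / (2 * q) * s) ^ 2 =
        β * q * (N ^ 2 / (lam * a)) + a / q * (lam / 4 * β * s ^ 2) - β * s * N := by
      field_simp
      ring
    linarith
  have y₀ := young (N₀ * y ^ 2)
  have y₁ := young (N₁ * y ^ 4)
  have m₁ : (1 - β * s) * Y ≤ β * q * Y := mul_le_mul_of_nonneg_right hβs hY0
  calc Y - a / q * (lam / 2 * β * s ^ 2) ≤ β * q * (Y + Q) := by
        rw [mul_add, hQ, mul_add]
        have : β * s * Y = β * s * (N₀ * y ^ 2) + β * s * (N₁ * y ^ 4) := by rw [hY]; ring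
        linarith
    _ ≤ b * q * (Y + Q) := by gcongr
    _ ≤ b * q * (q ^ 6 * (p₁ + p₂ * y ^ 2 + p₃ * y ^ 6) * y ^ 2) :=
        mul_le_mul_of_nonneg_left hX (by have := hβ.trans_le hb; positivity)
    _ = _ := by ring

/-- Young's inequality `x y ≤ m x² + y² / (4 m)`. -/
theorem young_le {m : ℝ} (hm : 0 < m) (x y : ℝ) : x * y ≤ m * x ^ 2 + y ^ 2 / (4 * m) := by
  have h : 0 ≤ m * (x - y / (2 * m)) ^ 2 := by positivity
  have e : m * (x - y / (2 * m)) ^ 2 = m * x ^ 2 + y ^ 2 / (4 * m) - x * y := by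
    field_simp
    ring
  linarith

/-- Splits a coefficient at the level q: σ is at most its excess over q plus q. -/
theorem sq_le_two_mul_add {σ q : ℝ} (hσ : 0 ≤ σ) :
    σ ^ 2 ≤ 2 * max (σ - q) 0 ^ 2 + 2 * q ^ 2 := by
  have h1 : σ ≤ max (σ - q) 0 + q := by linarith [le_max_left (σ - q) 0]
  have h2 : σ ^ 2 ≤ (max (σ - q) 0 + q) ^ 2 := pow_le_pow_left₀ hσ h1 2
  nlinarith [sq_nonneg (max (σ - q) 0 - q)]

/-- The effect of the uncertain terms on `y²/2`, with a free weight `m` on the infinite-dimensional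
state. -/
theorem uncertainty_upper_bound {a q m n φ θ ℓ d y : ℝ} (ha : 0 < a) (hq : 0 < q) (hm : 0 < m)
    (hφ : 0 ≤ φ) (hℓ : |ℓ| ≤ n + φ * |y|) :
    y * (θ * ℓ + d) ≤ m * n ^ 2 + (q ^ 2 / (2 * m) + q * φ + q / (4 * a)) * y ^ 2
      + (q / (16 * a * m ^ 2) + q * φ ^ 2 / (4 * a)) * y ^ 4
      + a / q * (d ^ 2 + max (|θ| - q) 0 ^ 2 + (max (|θ| - q) 0 ^ 2) ^ 2) := by
  set r := max (|θ| - q) 0 with hr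
  have hr0 : 0 ≤ r := le_max_right _ _
  have haq : 0 < a / q := by positivity
  have hθ : |θ| ≤ r + q := by linarith [le_max_left (|θ| - q) 0]
  have hθ2 := sq_le_two_mul_add (q := q) (abs_nonneg θ)
  rw [← hr] at hθ2
  have h1 : y * (θ * ℓ) ≤ |y| * |θ| * n + |θ| * (φ * y ^ 2) := by
    calc y * (θ * ℓ) ≤ |y * (θ * ℓ)| := le_abs_self _
      _ = |y| * |θ| * |ℓ| := by rw [abs_mul, abs_mul]; ring
      _ ≤ |y| * |θ| * (n + φ * |y|) := by gcongr
      _ = |y| * |θ| * n + |θ| * (φ * |y| ^ 2) := by ring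
      _ = _ := by rw [sq_abs]
  have h2 : |y| * |θ| * n ≤ m * n ^ 2 + (2 * r ^ 2 + 2 * q ^ 2) * y ^ 2 / (4 * m) := by
    have h := young_le hm n (|y| * |θ|)
    have h' : (|y| * |θ|) ^ 2 ≤ (2 * r ^ 2 + 2 * q ^ 2) * y ^ 2 := by
      rw [mul_pow, sq_abs, mul_comm]
      gcongr
    have := div_le_div_of_nonneg_right h' (show 0 ≤ 4 * m by positivity)
    linarith
  have h3 : |θ| * (φ * y ^ 2) ≤ r * (φ * y ^ 2) + q * (φ * y ^ 2) := by
    rw [← add_mul]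
    gcongr
  -- The three products involving r or d are all weighted by a/q, so that their influence fades as
  -- the gain grows.
  have h4 := young_le haq r (φ * y ^ 2)
  have h5 := young_le haq (r ^ 2) (y ^ 2 / (2 * m))
  have h6 := young_le haq d y
  have e : m * n ^ 2 + (2 * r ^ 2 + 2 * q ^ 2) * y ^ 2 / (4 * m)
      + (a / q * r ^ 2 + (φ * y ^ 2) ^ 2 / (4 * (a / q)) + q * (φ * y ^ 2))
      + (a / q * d ^ 2 + y ^ 2 / (4 * (a / q)))
      = m * n ^ 2 + (q ^ 2 / (2 * m) + q * φ + q / (4 * a)) * y ^ 2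
      + (q / (16 * a * m ^ 2) + q * φ ^ 2 / (4 * a)) * y ^ 4
      + a / q * (d ^ 2 + r ^ 2 + (r ^ 2) ^ 2)
      + (r ^ 2 * (y ^ 2 / (2 * m)) - (a / q * (r ^ 2) ^ 2
        + (y ^ 2 / (2 * m)) ^ 2 / (4 * (a / q)))) := by
    field_simp
    ring
  have e2 : y * (θ * ℓ + d) = y * (θ * ℓ) + d * y := by ring
  linarith

/-- The design inequalities, multiplied by κ⁶ to match the hypotheses of `damping_lower_bound`. -/
theorem IsDesign.bounds {p : Gains} (hp : p.Valid) {φ P₁ P₂ P₃ : ℝ → ℝ}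
    (hP : IsDesign p φ P₁ P₂ P₃) (y : ℝ) :
    1 / (4 * p.a) * (p.κ + 4 * p.a * p.C + 4 * p.κ ^ 3 + 4 * p.a * p.κ * φ y + 8 * p.a * p.κ ^ 2)
        ≤ p.κ ^ 6 * P₁ y ∧
      p.κ / (4 * p.a ^ 3) *
        (1 / (16 * p.κ) * (p.κ + 4 * p.a * p.C + 4 * p.κ ^ 3 + 4 * p.a * p.κ * φ y) ^ 2
          + p.κ ^ 2 + p.a ^ 2 * φ y ^ 2 + 4 * p.a ^ 2 * (p.κ ^ 3 + 1)) ≤ p.κ ^ 6 * P₂ y ∧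
      p.κ ^ 2 / (64 * p.a ^ 7) * ((p.κ ^ 2 + p.a ^ 2 * φ y ^ 2) ^ 2 + 16 * p.a ^ 4)
        ≤ p.κ ^ 6 * P₃ y := by
  have hκ := hp.κ_pos
  have ha := hp.a_pos
  have hκ6 : 0 ≤ p.κ ^ 6 := by positivity
  refine ⟨?_, ?_, ?_⟩
  · refine le_trans (le_of_eq ?_) (mul_le_mul_of_nonneg_left (hP.bound₁ y) hκ6)
    field_simp
  · refine le_trans (le_of_eq ?_) (mul_le_mul_of_nonneg_left (hP.bound₂ y) hκ6)
    field_simp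
  · refine le_trans (le_of_eq ?_) (mul_le_mul_of_nonneg_left (hP.bound₃ y) hκ6)
    field_simp

/-- The closed-loop estimate for `y²/2` with a fixed weight on the infinite-dimensional state, in
the presence of an additional destabilizing term `σ² y²`. -/
theorem control_bound_with_coupling {p : Gains} (hp : p.Valid) {φ P₁ P₂ P₃ : ℝ → ℝ} (hφ : ∀ y, 0 ≤ φ y)
    (hP : IsDesign p φ P₁ P₂ P₃) {z b β n θ ℓ d σ y : ℝ} (hβ : 0 < β) (hb : β ≤ b)
    (hℓ : |ℓ| ≤ n + φ y * |y|) (hσ : 0 ≤ σ) :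
    y * (b * feedback p P₁ P₂ P₃ z y + θ * ℓ + d) + σ ^ 2 * y ^ 2
      ≤ p.a / (2 * p.κ) * n ^ 2 - p.C * y ^ 2 + p.a / (p.κ + Real.exp z) *
        (d ^ 2 + gFun p.κ |θ| z + gFun p.κ |θ| z ^ 2 + 4 * β * gFun p.κ (1 / β) z
          + gFun p.κ σ z ^ 2) := by
  obtain ⟨b₁, b₂, b₃⟩ := hP.bounds hp y
  have hκ := hp.κ_pos
  have ha := hp.a_pos
  have hC := hp.C_pos
  have hφy := hφ y
  simp only [gFun, sub_sub, feedback]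
  have hqκ : p.κ ≤ p.κ + Real.exp z := by linarith [Real.exp_pos z]
  generalize p.κ + Real.exp z = q at *
  generalize φ y = φ at *
  generalize P₁ y = P₁ at *
  generalize P₂ y = P₂ at *
  generalize P₃ y = P₃ at *
  obtain ⟨ε, Γ, κ, a, C⟩ := p
  dsimp only at *
  have hq : 0 < q := hκ.trans_le hqκ
  -- A weight independent of q and below 1, so that the dissipation -‖w‖² of Φ can absorb it.
  have hu := uncertainty_upper_bound (m := a / (2 * κ)) (θ := θ) (d := d) ha hq (by positivity)
    hφy hℓ
  have h1p : 1 ≤ q / κ := by rw [le_div_iff₀ hκ]; linarith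
  have hp2 : (q / κ) ^ 2 ≤ (q / κ) ^ 3 := pow_le_pow_right₀ h1p (by norm_num)
  have hp1 : q / κ ≤ (q / κ) ^ 3 := le_self_pow₀ h1p (by norm_num)
  have hp0 : 1 ≤ (q / κ) ^ 3 := one_le_pow₀ h1p
  -- N₀ and N₁ collect the coefficients of y² and y⁴ to be dominated, with 2q² and q/a due to σ; M₀
  -- and M₁ are their values at q = κ. The choice lam = 8 yields the factor 4β.
  have hd := damping_lower_bound (y := y) (κ := κ) (a := a) (q := q) (b := b) (β := β) (lam := 8)
    (N₀ := C + q ^ 2 * κ / a + q * φ + q / (4 * a) + 2 * q ^ 2)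
    (N₁ := q * κ ^ 2 / (4 * a ^ 3) + q * φ ^ 2 / (4 * a) + q / a)
    (M₀ := 1 / (4 * a) * (κ + 4 * a * C + 4 * κ ^ 3 + 4 * a * κ * φ + 8 * a * κ ^ 2))
    (M₁ := κ / (4 * a ^ 3) * (κ ^ 2 + a ^ 2 * φ ^ 2 + 4 * a ^ 2))
    (p₁ := P₁) (p₂ := P₂) (p₃ := P₃) hκ ha hqκ hβ hb (by norm_num) (by positivity) (by positivity)
    (by
      have e : C + q ^ 2 * κ / a + q * φ + q / (4 * a) + 2 * q ^ 2 =
          1 * C + (q / κ) ^ 2 * (κ ^ 3 / a) + (q / κ) * (κ * φ) + (q / κ) * (κ / (4 * a))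
            + (q / κ) ^ 2 * (2 * κ ^ 2) := by field_simp
      rw [e]
      calc _ ≤ (q / κ) ^ 3 * C + (q / κ) ^ 3 * (κ ^ 3 / a) + (q / κ) ^ 3 * (κ * φ)
            + (q / κ) ^ 3 * (κ / (4 * a)) + (q / κ) ^ 3 * (2 * κ ^ 2) := by gcongr
        _ = _ := by field_simp; ring)
    (by
      calc _ = (q / κ) * (κ / (4 * a ^ 3) * (κ ^ 2 + a ^ 2 * φ ^ 2 + 4 * a ^ 2)) := by
            field_simp
        _ ≤ _ := by gcongr)
    b₁
    (by
      refine le_trans ?_ b₂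
      -- Remainder in (s + t)² ≤ 2s² + 2t² with t = 8aκ²; the summand κ³ in the bound on P₂ pays for
      -- 2t², the summand 1 for 4a² in M₁.
      have h : 0 ≤ 1 / (64 * a ^ 3) * (κ + 4 * a * C + 4 * κ ^ 3 + 4 * a * κ * φ
        - 8 * a * κ ^ 2) ^ 2 / 2 := by positivity
      refine le_of_sub_nonneg (le_trans h (le_of_eq ?_))
      field_simp
      ring)
    (by
      refine le_trans ?_ b₃
      -- The same inequality with t = 4a²; the summand 16a⁴ in the bound on P₃ pays for it.
      have h : 0 ≤ κ ^ 2 / (128 * a ^ 7) * (κ ^ 2 + a ^ 2 * φ ^ 2 - 4 * a ^ 2) ^ 2 := by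
        positivity
      refine le_of_sub_nonneg (le_trans h (le_of_eq ?_))
      field_simp
      ring)
  have hs := mul_le_mul_of_nonneg_right (sq_le_two_mul_add (q := q) hσ) (sq_nonneg y)
  have hv := young_le (show 0 < a / q by positivity) (max (σ - q) 0 ^ 2) (2 * y ^ 2)
  have e1 : (2 * y ^ 2) ^ 2 / (4 * (a / q)) = q / a * y ^ 4 := by
    field_simp
    ring
  have e2 : q ^ 2 / (2 * (a / (2 * κ))) = q ^ 2 * κ / a := by
    field_simp
  have e3 : q / (16 * a * (a / (2 * κ)) ^ 2) = q * κ ^ 2 / (4 * a ^ 3) := by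
    field_simp
    ring
  rw [e1] at hv
  rw [e2, e3] at hu
  have e4 : y * (b * (-q ^ 7 * (P₁ + P₂ * y ^ 2 + P₃ * y ^ 6) * y) + θ * ℓ + d) =
      y * (θ * ℓ + d) - b * (q ^ 7 * (P₁ + P₂ * y ^ 2 + P₃ * y ^ 6) * y ^ 2) := by ring
  rw [e4]
  have e5 : (8 : ℝ) / 2 = 4 := by norm_num
  rw [e5] at hd
  ring_nf at hu hd hs hv ⊢
  linarith

/-- The closed-loop estimate for `y²/2` in which all gains decay with the dynamic gain. -/
theorem control_bound {p : Gains} (hp : p.Valid) {φ P₁ P₂ P₃ : ℝ → ℝ} (hφ : ∀ y, 0 ≤ φ y)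
    (hP : IsDesign p φ P₁ P₂ P₃) {z b β n θ ℓ d y : ℝ} (hβ : 0 < β) (hb : β ≤ b)
    (hℓ : |ℓ| ≤ n + φ y * |y|) :
    y * (b * feedback p P₁ P₂ P₃ z y + θ * ℓ + d)
      ≤ -p.C * y ^ 2 + p.a / (p.κ + Real.exp z) *
        (1 / 2 * n ^ 2 + d ^ 2 + gFun p.κ |θ| z + gFun p.κ |θ| z ^ 2
          + 2 * β * gFun p.κ (1 / β) z) := by
  obtain ⟨b₁, b₂, b₃⟩ := hP.bounds hp y
  have hκ := hp.κ_pos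
  have ha := hp.a_pos
  have hC := hp.C_pos
  have hφy := hφ y
  simp only [gFun, sub_sub, feedback]
  have hqκ : p.κ ≤ p.κ + Real.exp z := by linarith [Real.exp_pos z]
  generalize p.κ + Real.exp z = q at *
  generalize φ y = φ at *
  generalize P₁ y = P₁ at *
  generalize P₂ y = P₂ at *
  generalize P₃ y = P₃ at *
  obtain ⟨ε, Γ, κ, a, C⟩ := p
  dsimp only at *
  have hq : 0 < q := hκ.trans_le hqκ
  -- The weight on the state now decays with q. The price is coefficients of order q³, the largest
  -- growth that `damping_lower_bound` tolerates.
  have hu := uncertainty_upper_bound (m := a / (2 * q)) (θ := θ) (d := d) ha hq (by positivity)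
    hφy hℓ
  have h1p : 1 ≤ q / κ := by rw [le_div_iff₀ hκ]; linarith
  have hp1 : q / κ ≤ (q / κ) ^ 3 := le_self_pow₀ h1p (by norm_num)
  have hp0 : 1 ≤ (q / κ) ^ 3 := one_le_pow₀ h1p
  have hd := damping_lower_bound (y := y) (κ := κ) (a := a) (q := q) (b := b) (β := β) (lam := 4)
    (N₀ := C + q ^ 3 / a + q * φ + q / (4 * a))
    (N₁ := q ^ 3 / (4 * a ^ 3) + q * φ ^ 2 / (4 * a))
    (M₀ := 1 / (4 * a) * (κ + 4 * a * C + 4 * κ ^ 3 + 4 * a * κ * φ))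
    (M₁ := κ / (4 * a ^ 3) * (κ ^ 2 + a ^ 2 * φ ^ 2))
    (p₁ := P₁) (p₂ := P₂) (p₃ := P₃) hκ ha hqκ hβ hb (by norm_num) (by positivity) (by positivity)
    (by
      have e : C + q ^ 3 / a + q * φ + q / (4 * a) =
          1 * C + (q / κ) ^ 3 * (κ ^ 3 / a) + (q / κ) * (κ * φ) + (q / κ) * (κ / (4 * a)) := by
        field_simp
      rw [e]
      calc _ ≤ (q / κ) ^ 3 * C + (q / κ) ^ 3 * (κ ^ 3 / a) + (q / κ) ^ 3 * (κ * φ)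
            + (q / κ) ^ 3 * (κ / (4 * a)) := by gcongr
        _ = _ := by field_simp; ring)
    (by
      have e : q ^ 3 / (4 * a ^ 3) + q * φ ^ 2 / (4 * a) =
          (q / κ) ^ 3 * (κ ^ 3 / (4 * a ^ 3)) + (q / κ) * (κ * φ ^ 2 / (4 * a)) := by
        field_simp
      rw [e]
      calc _ ≤ (q / κ) ^ 3 * (κ ^ 3 / (4 * a ^ 3)) + (q / κ) ^ 3 * (κ * φ ^ 2 / (4 * a)) := by
            gcongr
        _ = _ := by field_simp)
    (le_trans (mul_le_mul_of_nonneg_left (le_add_of_nonneg_right (by positivity))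
      (by positivity)) b₁)
    (by
      refine le_trans ?_ b₂
      have h : 0 ≤ κ / (4 * a ^ 3) * (4 * a ^ 2 * (κ ^ 3 + 1)) := by positivity
      refine le_of_sub_nonneg (le_trans h (le_of_eq ?_))
      field_simp
      ring)
    (by
      refine le_trans ?_ b₃
      have h : 0 ≤ κ ^ 2 / (64 * a ^ 7) * (16 * a ^ 4) := by positivity
      refine le_of_sub_nonneg (le_trans h (le_of_eq ?_))
      field_simp
      ring)
  have e1 : a / (2 * q) * n ^ 2 = a / q * (1 / 2 * n ^ 2) := by
    field_simp
  have e2 : q ^ 2 / (2 * (a / (2 * q))) = q ^ 3 / a := by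
    field_simp
  have e3 : q / (16 * a * (a / (2 * q)) ^ 2) = q ^ 3 / (4 * a ^ 3) := by
    field_simp
    ring
  rw [e1, e2, e3] at hu
  have e4 : y * (b * (-q ^ 7 * (P₁ + P₂ * y ^ 2 + P₃ * y ^ 6) * y) + θ * ℓ + d) =
      y * (θ * ℓ + d) - b * (q ^ 7 * (P₁ + P₂ * y ^ 2 + P₃ * y ^ 6) * y ^ 2) := by ring
  rw [e4]
  have e5 : (4 : ℝ) / 2 = 2 := by norm_num
  rw [e5] at hd
  ring_nf at hu hd ⊢
  linarith

end DADS

/-! ### Scalar analysis of the deadzone adaptation. -/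

noncomputable section

namespace DADS

section Scalar

/-- A function whose square has upper limit at most `K` has upper limit at most `√K`. -/
theorem limsup_le_sqrt {f : ℝ → ℝ} {K : ℝ} (hf : ∀ t, 0 ≤ f t) (hK : 0 ≤ K)
    (h : ∀ M, K < M → ∀ᶠ t in atTop, f t ^ 2 < M) : limsup f atTop ≤ Real.sqrt K := by
  refine le_of_forall_gt_imp_ge_of_dense fun S hS => ?_
  have hS0 : 0 ≤ S := (Real.sqrt_nonneg K).trans hS.le
  have h1 : K < S ^ 2 := by
    rw [← Real.sq_sqrt hK]
    exact pow_lt_pow_left₀ hS (Real.sqrt_nonneg K) two_ne_zero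
  refine limsup_le_of_le (isCoboundedUnder_le_of_le atTop hf) ?_
  filter_upwards [h _ h1] with t ht
  exact (lt_of_pow_lt_pow_left₀ 2 hS0 ht).le

variable {Y ζ : ℝ → ℝ} {Γ ε C D : ℝ}

theorem monotoneOn_of_ae_deriv_nonneg (hζ : LocallyAC ζ)
    (h : ∀ᵐ t ∂timeMeasure, 0 ≤ deriv ζ t) : MonotoneOn ζ (Ici 0) := by
  intro s hs t _ hst
  have h1 := (hζ.interval hs hst).neg.le_of_ae_deriv_nonpos hst (by
    filter_upwards [ae_timeMeasure_iff.1 h] with r hr hmem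
    rw [deriv.neg]
    have := hr ((mem_Ici.1 hs).trans hmem.1)
    linarith)
  simp only [Pi.neg_apply] at h1
  linarith

/-- The bound for a deadzone-adapted gain `ζ` driven by the excess of `Y` over `ε`. -/
theorem deadzone_gain_bound (hΓ : 0 < Γ) (hε : 0 < ε) (hC : 0 < C) (hD : 0 ≤ D)
    (hY : LocallyAC Y) (hY0 : ∀ t, 0 ≤ Y t) (hζ : LocallyAC ζ) (hζ0 : 0 < ζ 0)
    (hζd : ∀ᵐ t ∂timeMeasure, deriv ζ t = Γ * max (Y t - ε) 0)
    (hYd : ∀ᵐ t ∂timeMeasure, deriv Y t ≤ -(2 * C) * Y t + D / (1 + ζ t)) {T : ℝ} (hT : 0 ≤ T) :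
    ζ T ≤ ζ 0 + Γ / (2 * C) * Y 0 +
      D * ((2 * C * (1 + ζ 0) + ε * Γ) / (4 * C ^ 2 * ε * (1 + ζ 0))) := by
  have hmono : MonotoneOn ζ (Ici 0) := monotoneOn_of_ae_deriv_nonneg hζ
    (hζd.mono fun t ht => by rw [ht]; exact mul_nonneg hΓ.le (le_max_right _ _))
  have hζpos : ∀ t, 0 ≤ t → ζ 0 ≤ ζ t := fun t ht => hmono self_mem_Ici ht ht
  have hrhs : D * ((2 * C * (1 + ζ 0) + ε * Γ) / (4 * C ^ 2 * ε * (1 + ζ 0))) =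
      D / (2 * C * ε) + Γ / (2 * C) * (D / (2 * C * (1 + ζ 0))) := by
    field_simp
    ring
  rw [hrhs]
  -- Above this level the forcing D / (1 + ζ) is at most 2Cε.
  set m := max (ζ 0) (D / (2 * C * ε) - 1) with hm
  have hDC : 0 ≤ D / (2 * C * ε) := by positivity
  have hm1 : m ≤ ζ 0 + D / (2 * C * ε) := max_le (by linarith) (by linarith)
  have hrest : 0 ≤ Γ / (2 * C) * (D / (2 * C * (1 + ζ 0))) := by positivity
  have hYΓ : ∀ t, 0 ≤ Γ / (2 * C) * Y t := fun t => mul_nonneg (by positivity) (hY0 t)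
  rcases le_or_gt (ζ T) m with hTm | hTm
  · linarith [hYΓ 0]
  have hcont : ContinuousOn ζ (Icc 0 T) := by
    have := (hζ.interval le_rfl hT).continuousOn
    rwa [uIcc_of_le hT] at this
  obtain ⟨t₁, ht₁, hζt₁⟩ := intermediate_value_Icc hT hcont ⟨le_max_left _ _, hTm.le⟩
  have hsmall : ∀ t, t₁ ≤ t → D / (1 + ζ t) ≤ 2 * C * ε := by
    intro t ht
    have h1 : m ≤ ζ t := hζt₁.symm.le.trans (hmono ht₁.1 (ht₁.1.trans ht) ht)
    have h2 : D / (2 * C * ε) ≤ 1 + ζ t := by linarith [le_max_right (ζ 0) (D / (2 * C * ε) - 1)]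
    have h3 : 0 < 1 + ζ t := by linarith [hζpos t (ht₁.1.trans ht)]
    rw [div_le_iff₀ h3]
    rwa [div_le_iff₀ (by positivity), mul_comm] at h2
  have hh : LocallyAC (fun t => max (Y t - ε) 0) := by
    have := (hY.add (LocallyAC.const (-ε))).max_zero
    simpa only [← sub_eq_add_neg] using this
  -- From t₁ on, ζ + Γ/(2C) (Y - ε)⁺ does not increase: above the dead zone the decay of Y cancels
  -- the growth of ζ, and inside it both derivatives vanish.
  have hU := ((hζ.interval ht₁.1 ht₁.2).add
    ((hh.interval ht₁.1 ht₁.2).const_mul (Γ / (2 * C)))).le_of_ae_deriv_nonpos ht₁.2 (by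
      filter_upwards [ae_timeMeasure_iff.1 hζd, ae_timeMeasure_iff.1 hYd, hY.ae_differentiableAt,
        hζ.ae_differentiableAt, hh.ae_differentiableAt] with t h1 h2 h3 h4 h5 hmem
      have ht0 : 0 ≤ t := ht₁.1.trans hmem.1
      have h6 := ((h4 ht0).hasDerivAt.add ((h5 ht0).hasDerivAt.const_mul (Γ / (2 * C)))).deriv
      rw [h6, h1 ht0]
      rcases deriv_max_zero (f := fun t => Y t - ε) ((h3 ht0).sub_const ε) with ⟨h7, h8⟩ | ⟨h7, h8⟩
      · rw [h8, max_eq_left h7.le, deriv_sub_const]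
        have h9 := h2 ht0
        have h10 := hsmall t hmem.1
        have h11 : Γ / (2 * C) * deriv Y t ≤ Γ / (2 * C) * (-(2 * C) * (Y t - ε)) := by
          refine mul_le_mul_of_nonneg_left ?_ (by positivity)
          linarith
        have h12 : Γ / (2 * C) * (-(2 * C) * (Y t - ε)) = -(Γ * (Y t - ε)) := by
          field_simp
        linarith
      · rw [h8, max_eq_right h7]
        simp)
  simp only [Pi.add_apply] at hU
  -- Before t₁ only ζ ≥ ζ 0 is used.
  have hYt₁ : Y t₁ ≤ Y 0 + D / (2 * C * (1 + ζ 0)) := by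
    have h1 := (hY.interval le_rfl ht₁.1).gronwall (μ := 2 * C) (K := D / (2 * C * (1 + ζ 0)))
      ht₁.1 (by
        filter_upwards [ae_timeMeasure_iff.1 hYd] with t h1 hmem
        refine (h1 hmem.1).trans ?_
        have h2 : 2 * C * (D / (2 * C * (1 + ζ 0))) = D / (1 + ζ 0) := by field_simp
        rw [h2]
        have h3 : D / (1 + ζ t) ≤ D / (1 + ζ 0) :=
          div_le_div_of_nonneg_left hD (by linarith) (by linarith [hζpos t hmem.1])
        linarith)
    have h2 : Real.exp (-(2 * C) * (t₁ - 0)) ≤ 1 := by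
      rw [Real.exp_le_one_iff, sub_zero]
      nlinarith [ht₁.1]
    have h3 : 0 ≤ D / (2 * C * (1 + ζ 0)) := by positivity
    have h4 := Real.exp_pos (-(2 * C) * (t₁ - 0))
    nlinarith [hY0 0]
  have h1 : 0 ≤ Γ / (2 * C) * max (Y T - ε) 0 := mul_nonneg (by positivity) (le_max_right _ _)
  have h2 : Γ / (2 * C) * max (Y t₁ - ε) 0 ≤ Γ / (2 * C) * (Y 0 + D / (2 * C * (1 + ζ 0))) := by
    refine mul_le_mul_of_nonneg_left (max_le (by linarith) ?_) (by positivity)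
    have h3 : 0 ≤ D / (2 * C * (1 + ζ 0)) := by positivity
    linarith [hY0 0]
  rw [mul_add] at h2
  linarith

/-- If the gain `ζ` converges and the growth of `Y` is bounded, then `Y` enters the dead zone. -/
theorem deadzone_attractive (hΓ : 0 < Γ) (hY : LocallyAC Y) (hζ : LocallyAC ζ)
    (hζd : ∀ᵐ t ∂timeMeasure, deriv ζ t = Γ * max (Y t - ε) 0) {M l : ℝ}
    (hYd : ∀ᵐ t ∂timeMeasure, deriv Y t ≤ M) (hl : Tendsto ζ atTop (𝓝 l)) {η : ℝ} (hη : ε < η) :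
    ∀ᶠ t in atTop, Y t < η := by
  have hh : LocallyAC (fun t => max (Y t - ε) 0) := by
    have := (hY.add (LocallyAC.const (-ε))).max_zero
    simpa only [← sub_eq_add_neg] using this
  have h1 := hh.tendsto_zero_of_bounded_primitive hζ hΓ (fun t => le_max_right _ _)
    (M := max M 0) (by
      rw [ae_timeMeasure_iff] at hYd ⊢
      filter_upwards [hYd, hY.ae_differentiableAt] with t h1 h2 ht
      rcases deriv_max_zero (f := fun t => Y t - ε) ((h2 ht).sub_const ε) with ⟨-, h3⟩ | ⟨-, h3⟩
      · rw [h3, deriv_sub_const]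
        exact (h1 ht).trans (le_max_left _ _)
      · rw [h3]
        exact le_max_right _ _) hζd hl
  filter_upwards [h1.eventually (gt_mem_nhds (sub_pos.2 hη))] with t ht
  linarith [le_max_left (Y t - ε) 0]

end Scalar

/-! ### Constants of the theorem and essential bounds on the inputs. -/

theorem gFun_nonneg (κ s l : ℝ) : 0 ≤ gFun κ s l := sq_nonneg _

theorem gFun_mono {κ s s' l l' : ℝ} (hs : s ≤ s') (hl : l' ≤ l) : gFun κ s l ≤ gFun κ s' l' := by
  unfold gFun
  have h1 := Real.exp_le_exp.2 hl
  exact pow_le_pow_left₀ (le_max_right _ _) (max_le_max (by linarith) le_rfl) 2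

/-- Finiteness is needed: `supNorm` takes the value 0 when the norm is infinite. -/
theorem ae_norm_le_supNorm {E : Type} [NormedAddCommGroup E] {f : ℝ → E}
    (hf : eLpNorm f ⊤ timeMeasure < ⊤) : ∀ᵐ t ∂timeMeasure, ‖f t‖ ≤ supNorm f := by
  filter_upwards [ae_le_eLpNormEssSup (f := f) (μ := timeMeasure)] with t ht
  rw [← eLpNorm_exponent_top] at ht
  have h := ENNReal.toReal_mono hf.ne ht
  rwa [toReal_enorm] at h

theorem paramNorm_nonneg (c : ℝ) (θ₁₁ : L2) (θ₁₂ : ℝ) : 0 ≤ paramNorm c θ₁₁ θ₁₂ :=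
  Real.sqrt_nonneg _

theorem R_pos : 0 < R := Real.sqrt_pos.2 (by positivity)

theorem R_mul_paramNorm (c : ℝ) (θ₁₁ : L2) (θ₁₂ : ℝ) :
    R * paramNorm c θ₁₁ θ₁₂ =
      Real.sqrt (2 * Real.exp 1 * θ₁₂ ^ 2 + 8 * Real.exp 1 ^ 2 / c ^ 2 * ‖θ₁₁‖ ^ 2) := by
  rw [R, paramNorm, ← Real.sqrt_mul (by positivity)]
  congr 1
  ring

theorem Inputs.Admissible.ae_paramNorm_le {i : Inputs} (hi : i.Admissible) (c : ℝ) :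
    ∀ᵐ t ∂timeMeasure, paramNorm c (i.θ₁₁ t) (i.θ₁₂ t)
      ≤ supNorm (fun t => paramNorm c (i.θ₁₁ t) (i.θ₁₂ t)) := by
  have h : eLpNorm (fun t => paramNorm c (i.θ₁₁ t) (i.θ₁₂ t)) ⊤ timeMeasure < ⊤ := by
    refine (eLpNormEssSup_le_of_ae_bound (C := Real.sqrt (supNorm i.θ₁₂ ^ 2 +
      4 * Real.exp 1 / c ^ 2 * supNorm i.θ₁₁ ^ 2)) ?_).trans_lt ENNReal.ofReal_lt_top
    filter_upwards [ae_norm_le_supNorm hi.θ₁₁_mem.2, ae_norm_le_supNorm hi.θ₁₂_mem.2] with t h1 h2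
    rw [Real.norm_eq_abs, abs_of_nonneg (paramNorm_nonneg _ _ _), paramNorm]
    refine Real.sqrt_le_sqrt (add_le_add ?_ ?_)
    · rw [← sq_abs]
      exact pow_le_pow_left₀ (abs_nonneg _) h2 2
    · gcongr
  filter_upwards [ae_norm_le_supNorm h] with t ht
  exact (le_abs_self _).trans ht

theorem Inputs.Admissible.ae_essInf_le {i : Inputs} (hi : i.Admissible) :
    ∀ᵐ t ∂timeMeasure, essInf i.b timeMeasure ≤ i.b t :=
  _root_.ae_essInf_le ⟨0, Filter.eventually_map.2 (hi.b_pos.mono fun _ h => h.le)⟩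

theorem lowerConst_pos {c : ℝ} (hc : 0 < c) : 0 < lowerConst c := by
  unfold lowerConst
  positivity

theorem upperConst_pos {c : ℝ} (hc : 0 < c) : 0 < upperConst c := by
  unfold upperConst
  positivity

theorem mu_pos {p : Gains} (hp : p.Valid) {c : ℝ} (hc : 0 < c) : 0 < mu p c := by
  have hk := upperConst_pos hc
  have hκ := hp.κ_pos
  have hC := hp.C_pos
  exact lt_min (div_pos (by linarith [hp.two_κ_gt]) (by positivity)) (by positivity)

theorem G_nonneg (c : ℝ) : 0 ≤ G c := by
  unfold G
  positivity

theorem ZConst_nonneg {p : Gains} (hp : p.Valid) (c : ℝ) {i : Inputs} (hi : i.Admissible)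
    (z₀ : ℝ) : 0 ≤ ZConst p c i z₀ := by
  have hκ := hp.κ_pos
  have ha := hp.a_pos
  have hb := hi.b_inf_pos
  have hG := G_nonneg c
  have h1 := gFun_nonneg p.κ (supNorm i.θ₂) z₀
  have h2 := gFun_nonneg p.κ (1 / essInf i.b timeMeasure) z₀
  unfold ZConst
  positivity

theorem BConst_nonneg {p : Gains} (hp : p.Valid) {c : ℝ} (hc : 0 < c) {i : Inputs}
    (hi : i.Admissible) (w₀ : L2) (y₀ z₀ : ℝ) : 0 ≤ BConst p c i w₀ y₀ z₀ := by
  have hb := hi.b_inf_pos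
  have hZ := ZConst_nonneg hp c hi z₀
  have hk := lowerConst_pos hc
  have hk' := upperConst_pos hc
  have hμ := mu_pos hp hc
  have h1 := gFun_nonneg p.κ (supNorm i.θ₂) z₀
  have h2 := gFun_nonneg p.κ (1 / essInf i.b timeMeasure) z₀
  unfold BConst
  positivity

/-- The Lyapunov functional `Φ(w) + y²/2` along a solution. -/
def lyapunov (c : ℝ) (w : ℝ → L2) (y : ℝ → ℝ) (t : ℝ) : ℝ := Phi c (w t) + 1 / 2 * (y t * y t)

theorem lyapunov_lower {c : ℝ} (hc : 0 < c) (w : ℝ → L2) (y : ℝ → ℝ) (t : ℝ) :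
    lowerConst c * ‖w t‖ ^ 2 + 1 / 2 * |y t| ^ 2 ≤ lyapunov c w y t := by
  have := lowerConst_mul_le_Phi hc (w t)
  rw [lyapunov, sq_abs]
  linarith [sq (y t)]

/-! ### Estimates along a solution. -/

namespace IsSolution

variable {p : Gains} {φ P₁ P₂ P₃ : ℝ → ℝ} {c : ℝ} {L : H1 → ℝ → ℝ} {K₁ : ℝ → ℝ → ℝ}
  {K₂ : ℝ → ℝ} {i : Inputs} {w : ℝ → L2} {W : ℝ → H1} {y z : ℝ → ℝ}

theorem locallyAC_halfSq (hsol : IsSolution p P₁ P₂ P₃ c L K₁ K₂ i w W y z) :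
    LocallyAC (fun t => 1 / 2 * (y t * y t)) :=
  (LocallyAC.const (1 / 2)).mul (hsol.y_ac.mul hsol.y_ac)

theorem locallyAC_lyapunov (hsol : IsSolution p P₁ P₂ P₃ c L K₁ K₂ i w W y z) :
    LocallyAC (lyapunov c w y) :=
  hsol.Phi_ac.add hsol.locallyAC_halfSq

theorem locallyAC_exp (hsol : IsSolution p P₁ P₂ P₃ c L K₁ K₂ i w W y z) :
    LocallyAC (fun t => Real.exp (z t)) :=
  LocallyAC.of_contDiffOn hsol.z_C1.exp

/-- Passing to e^z cancels the factor e^{-z} of the update law, which gives the form required by the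
deadzone lemmas. -/
theorem deriv_exp (hsol : IsSolution p P₁ P₂ P₃ c L K₁ K₂ i w W y z) :
    ∀ᵐ t ∂timeMeasure, deriv (fun t => Real.exp (z t)) t
      = p.Γ * max (1 / 2 * (y t * y t) - p.ε) 0 := by
  filter_upwards [hsol.gain] with t ht
  rw [ht.exp.deriv, updateLaw]
  have h1 : Real.exp (z t) * (p.Γ * Real.exp (-z t) * max (y t ^ 2 / 2 - p.ε) 0) =
      (Real.exp (z t) * Real.exp (-z t)) * (p.Γ * max (y t ^ 2 / 2 - p.ε) 0) := by ring
  have h2 : 1 / 2 * (y t * y t) = y t ^ 2 / 2 := by ring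
  rw [h1, h2, ← Real.exp_add, add_neg_cancel, Real.exp_zero, one_mul]

theorem monotoneOn_gain (hp : p.Valid) (hsol : IsSolution p P₁ P₂ P₃ c L K₁ K₂ i w W y z) :
    MonotoneOn z (Ici 0) := by
  have h := monotoneOn_of_ae_deriv_nonneg hsol.locallyAC_exp (hsol.deriv_exp.mono fun t ht => by
    rw [ht]
    exact mul_nonneg hp.Γ_pos.le (le_max_right _ _))
  exact fun s hs t ht hst => Real.exp_le_exp.1 (h hs ht hst)

theorem deriv_Phi_le (hc : 0 < c) (hLK : UncertaintyBounds φ L K₁ K₂)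
    (hsol : IsSolution p P₁ P₂ P₃ c L K₁ K₂ i w W y z) :
    ∀ᵐ t ∂timeMeasure, ∃ D, HasDerivAt (fun t => Phi c (w t)) D t ∧
      D ≤ -‖w t‖ ^ 2 + (R * paramNorm c (i.θ₁₁ t) (i.θ₁₂ t)) ^ 2 * y t ^ 2
        + G c * ‖i.δ t‖ ^ 2 := by
  filter_upwards [hsol.w_mem_H1, hsol.pde, hsol.boundary] with t h1 ⟨wt, h2, h3⟩ h4
  refine ⟨_, hasDerivAt_Phi c h2, ?_⟩
  rw [← h1]
  refine transport_dissipation hc (W t) h4 ?_ h3 (fun x hx => hLK.K₁_le x hx (y t))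
  rw [abs_mul]
  exact mul_le_mul_of_nonneg_left (hLK.K₂_le _) (abs_nonneg _)

theorem hasDerivAt_halfSq {D t : ℝ} (h : HasDerivAt y D t) :
    HasDerivAt (fun t => 1 / 2 * (y t * y t)) (y t * D) t := by
  have h1 := (h.mul h).const_mul (1 / 2)
  refine h1.congr_deriv ?_
  ring

/-- The decay of the Lyapunov functional, for any lower bound `β` of the control coefficient. -/
theorem deriv_lyapunov_le (hp : p.Valid) (hφ : ∀ y, 0 ≤ φ y) (hP : IsDesign p φ P₁ P₂ P₃)
    (hc : 0 < c) (hLK : UncertaintyBounds φ L K₁ K₂)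
    (hsol : IsSolution p P₁ P₂ P₃ c L K₁ K₂ i w W y z) :
    ∀ᵐ t ∂timeMeasure, ∀ β, 0 < β → β ≤ i.b t →
      deriv (lyapunov c w y) t ≤ -mu p c * lyapunov c w y t + (G c * ‖i.δ t‖ ^ 2 +
        p.a / (p.κ + Real.exp (z t)) * (i.d t ^ 2 + gFun p.κ |i.θ₂ t| (z t)
          + gFun p.κ |i.θ₂ t| (z t) ^ 2 + 4 * β * gFun p.κ (1 / β) (z t)
          + gFun p.κ (R * paramNorm c (i.θ₁₁ t) (i.θ₁₂ t)) (z t) ^ 2)) := by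
  filter_upwards [hsol.deriv_Phi_le hc hLK, hsol.ode, hsol.w_mem_H1] with t ⟨D, h1, h2⟩ h3 h4
    β hβ hb
  have h5 := h1.add (hasDerivAt_halfSq h3)
  have h6 : deriv (lyapunov c w y) t = _ := h5.deriv
  rw [h6]
  have h7 := hLK.L_le (W t) (y t)
  rw [h4] at h7
  -- Taking σ = R‖θ₁‖ makes the extra term cancel the y² gain in the estimate of Φ'.
  have h8 := control_bound_with_coupling hp hφ hP (z := z t) (θ := i.θ₂ t) (d := i.d t) hβ hb h7
    (mul_nonneg R_pos.le (paramNorm_nonneg c (i.θ₁₁ t) (i.θ₁₂ t)))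
  have hκ := hp.κ_pos
  have hk := upperConst_pos hc
  -- What remains of the dissipation of ‖w‖² has coefficient 1 - a/(2κ), positive since 2κ > a; this
  -- determines μ.
  have h9 : mu p c * lyapunov c w y t ≤
      (1 - p.a / (2 * p.κ)) * ‖w t‖ ^ 2 + p.C * y t ^ 2 := by
    have hΦ0 : 0 ≤ Phi c (w t) :=
      (mul_nonneg (lowerConst_pos hc).le (sq_nonneg _)).trans (lowerConst_mul_le_Phi hc (w t))
    have h10 : mu p c * Phi c (w t) ≤ (1 - p.a / (2 * p.κ)) * ‖w t‖ ^ 2 := by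
      have hnum : 0 ≤ 2 * p.κ - p.a := by linarith [hp.two_κ_gt]
      calc mu p c * Phi c (w t)
          ≤ (2 * p.κ - p.a) / (2 * p.κ * upperConst c) * (upperConst c * ‖w t‖ ^ 2) :=
            mul_le_mul (min_le_left _ _) (Phi_le_upperConst_mul hc _) hΦ0 (by positivity)
        _ = _ := by field_simp
    have h11 : mu p c * (1 / 2 * (y t * y t)) ≤ 2 * p.C * (1 / 2 * (y t * y t)) :=
      mul_le_mul_of_nonneg_right (min_le_right _ _) (by nlinarith [mul_self_nonneg (y t)])
    rw [lyapunov, mul_add]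
    linarith [sq (y t)]
  linarith

theorem deriv_halfSq_le (hp : p.Valid) (hφ : ∀ y, 0 ≤ φ y) (hP : IsDesign p φ P₁ P₂ P₃)
    (hLK : UncertaintyBounds φ L K₁ K₂)
    (hsol : IsSolution p P₁ P₂ P₃ c L K₁ K₂ i w W y z) :
    ∀ᵐ t ∂timeMeasure, ∀ β, 0 < β → β ≤ i.b t →
      deriv (fun t => 1 / 2 * (y t * y t)) t ≤ -p.C * y t ^ 2 +
        p.a / (p.κ + Real.exp (z t)) * (1 / 2 * ‖w t‖ ^ 2 + i.d t ^ 2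
          + gFun p.κ |i.θ₂ t| (z t) + gFun p.κ |i.θ₂ t| (z t) ^ 2
          + 2 * β * gFun p.κ (1 / β) (z t)) := by
  filter_upwards [hsol.ode, hsol.w_mem_H1] with t h3 h4 β hβ hb
  have h7 := hLK.L_le (W t) (y t)
  rw [h4] at h7
  rw [(hasDerivAt_halfSq h3).deriv]
  exact control_bound hp hφ hP hβ hb h7

theorem lyapunov_le (hp : p.Valid) (hφ : ∀ y, 0 ≤ φ y) (hP : IsDesign p φ P₁ P₂ P₃)
    (hc : 0 < c) (hLK : UncertaintyBounds φ L K₁ K₂) (hi : i.Admissible)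
    (hsol : IsSolution p P₁ P₂ P₃ c L K₁ K₂ i w W y z) {t : ℝ} (ht : 0 ≤ t) :
    lyapunov c w y t ≤ Real.exp (-mu p c * t) * lyapunov c w y 0
      + (mu p c)⁻¹ * ZConst p c i (z 0) := by
  have hμ := mu_pos hp hc
  have hZ := ZConst_nonneg hp c hi (z 0)
  have hκ := hp.κ_pos
  have ha := hp.a_pos
  have hβ := hi.b_inf_pos
  have hG := G_nonneg c
  have h := (hsol.locallyAC_lyapunov.interval le_rfl ht).gronwall (μ := mu p c)
    (K := (mu p c)⁻¹ * ZConst p c i (z 0)) ht (by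
      filter_upwards [ae_timeMeasure_iff.1 (hsol.deriv_lyapunov_le hp hφ hP hc hLK),
        ae_timeMeasure_iff.1 hi.ae_essInf_le, ae_timeMeasure_iff.1 (hi.ae_paramNorm_le c),
        ae_timeMeasure_iff.1 (ae_norm_le_supNorm hi.δ_mem.2),
        ae_timeMeasure_iff.1 (ae_norm_le_supNorm hi.d_mem.2),
        ae_timeMeasure_iff.1 (ae_norm_le_supNorm hi.θ₂_mem.2)] with s h1 h2 h3 h4 h5 h6 hs
      refine (h1 hs.1 _ hβ (h2 hs.1)).trans ?_
      have hz : z 0 ≤ z s := hsol.monotoneOn_gain hp self_mem_Ici hs.1 hs.1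
      have hd : i.d s ^ 2 ≤ supNorm i.d ^ 2 := by
        rw [← sq_abs]
        exact pow_le_pow_left₀ (abs_nonneg _) (h5 hs.1) 2
      have hg1 : gFun p.κ |i.θ₂ s| (z s) ≤ gFun p.κ (supNorm i.θ₂) (z 0) :=
        gFun_mono (h6 hs.1) hz
      have hg2 := gFun_mono (κ := p.κ) (le_refl (1 / essInf i.b timeMeasure)) hz
      have hg3 := gFun_mono (κ := p.κ) (mul_le_mul_of_nonneg_left (h3 hs.1) R_pos.le) hz
      have hn1 := gFun_nonneg p.κ |i.θ₂ s| (z s)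
      have hn2 := gFun_nonneg p.κ (1 / essInf i.b timeMeasure) (z s)
      have hn3 := gFun_nonneg p.κ (R * paramNorm c (i.θ₁₁ s) (i.θ₁₂ s)) (z s)
      have hδ := pow_le_pow_left₀ (norm_nonneg _) (h4 hs.1) 2
      have hez := Real.exp_le_exp.2 hz
      rw [← mul_assoc, mul_inv_cancel₀ hμ.ne', one_mul, ZConst,
        add_assoc (G c * supNorm i.δ ^ 2), ← mul_add, ← add_assoc (supNorm i.d ^ 2 + _ + _)]
      gcongr)
  rw [sub_zero] at h
  have h1 : 0 ≤ Real.exp (-mu p c * t) * ((mu p c)⁻¹ * ZConst p c i (z 0)) := by positivity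
  rw [mul_sub] at h
  linarith

theorem norm_sq_le (hp : p.Valid) (hφ : ∀ y, 0 ≤ φ y) (hP : IsDesign p φ P₁ P₂ P₃)
    (hc : 0 < c) (hLK : UncertaintyBounds φ L K₁ K₂) (hi : i.Admissible)
    (hsol : IsSolution p P₁ P₂ P₃ c L K₁ K₂ i w W y z) {t : ℝ} (ht : 0 ≤ t) :
    2 * lowerConst c * ‖w t‖ ^ 2 + |y t| ^ 2
      ≤ Real.exp (-mu p c * t) * (2 * upperConst c * ‖w 0‖ ^ 2 + |y 0| ^ 2)
        + 2 * (mu p c)⁻¹ * ZConst p c i (z 0) := by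
  have h1 := hsol.lyapunov_le hp hφ hP hc hLK hi ht
  have h2 := lyapunov_lower hc w y t
  have h3 : lyapunov c w y 0 ≤ 1 / 2 * (2 * upperConst c * ‖w 0‖ ^ 2 + |y 0| ^ 2) := by
    have := Phi_le_upperConst_mul hc (w 0)
    rw [lyapunov, sq_abs]
    linarith [sq (y 0)]
  have h4 := mul_le_mul_of_nonneg_left h3 (Real.exp_pos (-mu p c * t)).le
  linarith

/-- ‖w‖ is already bounded by the Lyapunov estimate, so the bracket is at most the constant B while
the factor a/(κ + e^z) survives. -/
theorem deriv_halfSq_le_BConst (hp : p.Valid) (hφ : ∀ y, 0 ≤ φ y)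
    (hP : IsDesign p φ P₁ P₂ P₃) (hc : 0 < c) (hLK : UncertaintyBounds φ L K₁ K₂)
    (hi : i.Admissible) (hsol : IsSolution p P₁ P₂ P₃ c L K₁ K₂ i w W y z) :
    ∀ᵐ t ∂timeMeasure, deriv (fun t => 1 / 2 * (y t * y t)) t ≤
      -(2 * p.C) * (1 / 2 * (y t * y t))
        + p.a * BConst p c i (w 0) (y 0) (z 0) / (p.κ + Real.exp (z t)) := by
  have hβ := hi.b_inf_pos
  have hκ := hp.κ_pos
  have ha := hp.a_pos
  have hk := lowerConst_pos hc
  have hk' := upperConst_pos hc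
  filter_upwards [hsol.deriv_halfSq_le hp hφ hP hLK, hi.ae_essInf_le,
    ae_norm_le_supNorm hi.d_mem.2, ae_norm_le_supNorm hi.θ₂_mem.2,
    ae_restrict_mem measurableSet_Ici] with t h1 h2 h3 h4 ht
  refine (h1 _ hβ h2).trans ?_
  have hz : z 0 ≤ z t := hsol.monotoneOn_gain hp self_mem_Ici ht ht
  have hd : i.d t ^ 2 ≤ supNorm i.d ^ 2 := by
    rw [← sq_abs]
    exact pow_le_pow_left₀ (abs_nonneg _) h3 2
  have hg1 : gFun p.κ |i.θ₂ t| (z t) ≤ gFun p.κ (supNorm i.θ₂) (z 0) := gFun_mono h4 hz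
  have hg1' := pow_le_pow_left₀ (gFun_nonneg _ _ _) hg1 2
  have hg2 := mul_le_mul_of_nonneg_left
    (gFun_mono (κ := p.κ) (le_refl (1 / essInf i.b timeMeasure)) hz)
    (show 0 ≤ 2 * essInf i.b timeMeasure by positivity)
  have hw : 1 / 2 * ‖w t‖ ^ 2 ≤ 1 / (2 * lowerConst c) *
      (upperConst c * ‖w 0‖ ^ 2 + 1 / 2 * |y 0| ^ 2 + (mu p c)⁻¹ * ZConst p c i (z 0)) := by
    have h5 := hsol.norm_sq_le hp hφ hP hc hLK hi ht
    have h6 : Real.exp (-mu p c * t) ≤ 1 := by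
      rw [Real.exp_le_one_iff]
      have := mul_nonneg (mu_pos hp hc).le (mem_Ici.1 ht)
      linarith
    have h7 : Real.exp (-mu p c * t) * (2 * upperConst c * ‖w 0‖ ^ 2 + |y 0| ^ 2) ≤
        2 * upperConst c * ‖w 0‖ ^ 2 + |y 0| ^ 2 := mul_le_of_le_one_left (by positivity) h6
    rw [one_div_mul_eq_div (2 * lowerConst c), le_div_iff₀ (by positivity)]
    linarith [sq_nonneg |y t|]
  have hq : 0 < p.a / (p.κ + Real.exp (z t)) := by positivity
  have h8 : p.a * BConst p c i (w 0) (y 0) (z 0) / (p.κ + Real.exp (z t)) =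
      p.a / (p.κ + Real.exp (z t)) * BConst p c i (w 0) (y 0) (z 0) := by ring
  rw [h8]
  refine add_le_add (le_of_eq (by ring)) (mul_le_mul_of_nonneg_left ?_ hq.le)
  rw [BConst]
  linarith

theorem exp_gain_le (hp : p.Valid) (hφ : ∀ y, 0 ≤ φ y) (hP : IsDesign p φ P₁ P₂ P₃)
    (hc : 0 < c) (hLK : UncertaintyBounds φ L K₁ K₂) (hi : i.Admissible)
    (hsol : IsSolution p P₁ P₂ P₃ c L K₁ K₂ i w W y z) {t : ℝ} (ht : 0 ≤ t) :
    Real.exp (z t) ≤ Real.exp (z 0) + p.Γ / (4 * p.C) * |y 0| ^ 2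
      + p.a * BConst p c i (w 0) (y 0) (z 0) *
        ((2 * p.C * (1 + Real.exp (z 0)) + p.ε * p.Γ)
          / (4 * p.C ^ 2 * p.ε * min 1 p.κ * (1 + Real.exp (z 0)))) := by
  have hκ := hp.κ_pos
  have ha := hp.a_pos
  have hC := hp.C_pos
  have hε := hp.ε_pos
  have hB := BConst_nonneg hp hc hi (w 0) (y 0) (z 0)
  have hm : 0 < min 1 p.κ := lt_min one_pos hκ
  have h := deadzone_gain_bound (Y := fun t => 1 / 2 * (y t * y t))
    (ζ := fun t => Real.exp (z t)) (D := p.a * BConst p c i (w 0) (y 0) (z 0) / min 1 p.κ)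
    hp.Γ_pos hε hC (by positivity) hsol.locallyAC_halfSq
    (fun t => mul_nonneg (by norm_num) (mul_self_nonneg _)) hsol.locallyAC_exp (Real.exp_pos _)
    hsol.deriv_exp (by
      filter_upwards [hsol.deriv_halfSq_le_BConst hp hφ hP hc hLK hi] with s hs
      refine hs.trans (add_le_add le_rfl ?_)
      rw [div_div]
      have he := Real.exp_pos (z s)
      refine div_le_div_of_nonneg_left (by positivity) (by positivity) ?_
      -- Uses κ + ζ ≥ min(1, κ)(1 + ζ) to pass to the normalized forcing D / (1 + ζ).
      nlinarith [min_le_left 1 p.κ, min_le_right 1 p.κ]) ht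
  refine h.trans (le_of_eq ?_)
  rw [sq_abs]
  have h1 := Real.exp_pos (z 0)
  field_simp
  ring

theorem exists_tendsto_gain (hp : p.Valid) (hφ : ∀ y, 0 ≤ φ y) (hP : IsDesign p φ P₁ P₂ P₃)
    (hc : 0 < c) (hLK : UncertaintyBounds φ L K₁ K₂) (hi : i.Admissible)
    (hsol : IsSolution p P₁ P₂ P₃ c L K₁ K₂ i w W y z) :
    ∃ l, Tendsto z atTop (𝓝 l) := by
  have hmono : Monotone fun t => z (max t 0) := fun s t hst =>
    hsol.monotoneOn_gain hp (mem_Ici.2 (le_max_right _ _)) (mem_Ici.2 (le_max_right _ _))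
      (max_le_max hst le_rfl)
  have hbdd : BddAbove (range fun t => z (max t 0)) := by
    obtain ⟨M, hM⟩ : ∃ M, ∀ t, 0 ≤ t → Real.exp (z t) ≤ M :=
      ⟨_, fun t ht => hsol.exp_gain_le hp hφ hP hc hLK hi ht⟩
    refine ⟨Real.log M, ?_⟩
    rintro _ ⟨t, rfl⟩
    have h := hM _ (le_max_right t 0)
    exact (Real.le_log_iff_exp_le ((Real.exp_pos _).trans_le h)).2 h
  refine ⟨_, (tendsto_atTop_ciSup hmono hbdd).congr' ?_⟩
  filter_upwards [eventually_ge_atTop 0] with t ht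
  rw [max_eq_left ht]

theorem eventually_halfSq_lt (hp : p.Valid) (hφ : ∀ y, 0 ≤ φ y) (hP : IsDesign p φ P₁ P₂ P₃)
    (hc : 0 < c) (hLK : UncertaintyBounds φ L K₁ K₂) (hi : i.Admissible)
    (hsol : IsSolution p P₁ P₂ P₃ c L K₁ K₂ i w W y z) {η : ℝ} (hη : p.ε < η) :
    ∀ᶠ t in atTop, 1 / 2 * (y t * y t) < η := by
  obtain ⟨l, hl⟩ := hsol.exists_tendsto_gain hp hφ hP hc hLK hi
  have hκ := hp.κ_pos
  have ha := hp.a_pos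
  have hC := hp.C_pos
  have hB := BConst_nonneg hp hc hi (w 0) (y 0) (z 0)
  refine deadzone_attractive hp.Γ_pos hsol.locallyAC_halfSq hsol.locallyAC_exp hsol.deriv_exp
    (M := p.a * BConst p c i (w 0) (y 0) (z 0) / p.κ) ?_
    ((Real.continuous_exp.tendsto l).comp hl) hη
  filter_upwards [hsol.deriv_halfSq_le_BConst hp hφ hP hc hLK hi] with t ht
  have h1 : p.a * BConst p c i (w 0) (y 0) (z 0) / (p.κ + Real.exp (z t)) ≤
      p.a * BConst p c i (w 0) (y 0) (z 0) / p.κ :=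
    div_le_div_of_nonneg_left (by positivity) hκ (by linarith [Real.exp_pos (z t)])
  have h2 : 0 ≤ 2 * p.C * (1 / 2 * (y t * y t)) :=
    mul_nonneg (by positivity) (mul_nonneg (by norm_num) (mul_self_nonneg _))
  linarith

theorem limsup_abs_le (hp : p.Valid) (hφ : ∀ y, 0 ≤ φ y) (hP : IsDesign p φ P₁ P₂ P₃)
    (hc : 0 < c) (hLK : UncertaintyBounds φ L K₁ K₂) (hi : i.Admissible)
    (hsol : IsSolution p P₁ P₂ P₃ c L K₁ K₂ i w W y z) :
    limsup (fun t => |y t|) atTop ≤ Real.sqrt (2 * p.ε) := by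
  refine limsup_le_sqrt (fun t => abs_nonneg _) (by linarith [hp.ε_pos]) fun M hM => ?_
  filter_upwards [hsol.eventually_halfSq_lt hp hφ hP hc hLK hi
    (show p.ε < 1 / 2 * M by linarith)] with t ht
  rw [sq_abs]
  linarith [sq (y t)]

/-- Φ' ≤ -Φ/k₂ + forcing, and the forcing is eventually controlled by the upper limits and |y|² <
2(ε + η); then η is taken small. -/
theorem limsup_norm_le (hp : p.Valid) (hφ : ∀ y, 0 ≤ φ y) (hP : IsDesign p φ P₁ P₂ P₃)
    (hc : 0 < c) (hLK : UncertaintyBounds φ L K₁ K₂) (hi : i.Admissible)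
    (hsol : IsSolution p P₁ P₂ P₃ c L K₁ K₂ i w W y z) :
    limsup (fun t => ‖w t‖) atTop
      ≤ Real.sqrt (upperConst c / lowerConst c *
        (2 * p.ε * R ^ 2 * limsup (fun t => paramNorm c (i.θ₁₁ t) (i.θ₁₂ t)) essTop ^ 2
          + G c * limsup (fun t => ‖i.δ t‖) essTop ^ 2)) := by
  have hk := lowerConst_pos hc
  have hk' := upperConst_pos hc
  have hG := G_nonneg c
  have hε := hp.ε_pos
  set A := limsup (fun t => paramNorm c (i.θ₁₁ t) (i.θ₁₂ t)) essTop with hA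
  set D := limsup (fun t => ‖i.δ t‖) essTop with hD
  refine limsup_le_sqrt (fun t => norm_nonneg _) (by positivity) fun M hM => ?_
  have hM' : 2 * p.ε * R ^ 2 * A ^ 2 + G c * D ^ 2 < lowerConst c * M / upperConst c := by
    rw [lt_div_iff₀ hk']
    rw [div_mul_eq_mul_div, div_lt_iff₀ hk] at hM
    linarith
  have hcont : Tendsto (fun η : ℝ => (2 * (p.ε + η)) * R ^ 2 * (A + η) ^ 2 + G c * (D + η) ^ 2)
      (𝓝[>] 0) (𝓝 ((2 * (p.ε + 0)) * R ^ 2 * (A + 0) ^ 2 + G c * (D + 0) ^ 2)) := by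
    refine Tendsto.mono_left (Continuous.tendsto ?_ 0) nhdsWithin_le_nhds
    fun_prop
  simp only [add_zero] at hcont
  obtain ⟨η, hη, hη0⟩ :=
    ((hcont.eventually (gt_mem_nhds hM')).and self_mem_nhdsWithin).exists
  have hη0 : 0 < η := hη0
  -- A real `limsup` controls the function eventually only when the function is essentially bounded
  -- above.
  have hbA : essTop.IsBoundedUnder (· ≤ ·) (fun t => paramNorm c (i.θ₁₁ t) (i.θ₁₂ t)) :=
    ⟨_, Filter.eventually_map.2 (eventually_essTop_of_ae (hi.ae_paramNorm_le c))⟩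
  have hbD : essTop.IsBoundedUnder (· ≤ ·) (fun t => ‖i.δ t‖) :=
    ⟨_, Filter.eventually_map.2 (eventually_essTop_of_ae (ae_norm_le_supNorm hi.δ_mem.2))⟩
  have hΦ := hsol.Phi_ac.eventually_lt (μ := (upperConst c)⁻¹)
    (K := upperConst c * ((2 * (p.ε + η)) * R ^ 2 * (A + η) ^ 2 + G c * (D + η) ^ 2))
    (M := lowerConst c * M) (by positivity) (by
      rw [lt_div_iff₀ hk'] at hη
      linarith) (by
      filter_upwards [eventually_essTop_of_ae (hsol.deriv_Phi_le hc hLK),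
        eventually_lt_of_limsup_lt (show A < A + η by linarith) hbA,
        eventually_lt_of_limsup_lt (show D < D + η by linarith) hbD,
        (inf_le_left : essTop ≤ atTop) (hsol.eventually_halfSq_lt hp hφ hP hc hLK hi
          (show p.ε < p.ε + η by linarith))] with t ⟨E, h1, h2⟩ h3 h4 h5
      rw [h1.deriv, ← mul_assoc, inv_mul_cancel₀ hk'.ne', one_mul]
      have h5' : 1 / 2 * (y t * y t) < p.ε + η := h5
      have h6 : (upperConst c)⁻¹ * Phi c (w t) ≤ ‖w t‖ ^ 2 := by
        rw [inv_mul_le_iff₀ hk']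
        exact Phi_le_upperConst_mul hc _
      have h7 : (R * paramNorm c (i.θ₁₁ t) (i.θ₁₂ t)) ^ 2 * y t ^ 2 ≤
          (R * (A + η)) ^ 2 * (2 * (p.ε + η)) := by
        have hR := R_pos
        have h8 := paramNorm_nonneg c (i.θ₁₁ t) (i.θ₁₂ t)
        have h9 : y t ^ 2 ≤ 2 * (p.ε + η) := by linarith [sq (y t)]
        gcongr
      have h8 : G c * ‖i.δ t‖ ^ 2 ≤ G c * (D + η) ^ 2 := by gcongr
      rw [mul_pow R (A + η)] at h7
      linarith)
  filter_upwards [hΦ] with t ht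
  exact lt_of_mul_lt_mul_left ((lowerConst_mul_le_Phi hc (w t)).trans_lt ht) hk.le

theorem tendsto_of_tendsto_lyapunov (hc : 0 < c)
    (h : Tendsto (lyapunov c w y) atTop (𝓝 0)) :
    Tendsto (fun t => |y t|) atTop (𝓝 0) ∧ Tendsto (fun t => ‖w t‖) atTop (𝓝 0) := by
  have hk := lowerConst_pos hc
  have key : ∀ {f : ℝ → ℝ} {k : ℝ}, 0 < k → (∀ t, 0 ≤ f t) →
      (∀ t, k * f t ^ 2 ≤ lyapunov c w y t) → Tendsto f atTop (𝓝 0) := by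
    intro f k hk hf hle
    have h1 : Tendsto (fun t => Real.sqrt (lyapunov c w y t / k)) atTop (𝓝 0) := by
      have := (h.div_const k).sqrt
      simpa using this
    refine squeeze_zero hf (fun t => Real.le_sqrt_of_sq_le ?_) h1
    rw [le_div_iff₀ hk, mul_comm]
    exact hle t
  refine ⟨key (k := 1 / 2) (by norm_num) (fun t => abs_nonneg _) fun t => ?_,
    key hk (fun t => norm_nonneg _) fun t => ?_⟩
  · have := lyapunov_lower hc w y t
    linarith [mul_nonneg hk.le (sq_nonneg ‖w t‖)]
  · have := lyapunov_lower hc w y t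
    linarith [sq_nonneg |y t|]

theorem tendsto_gFun_zero {s : ℝ → ℝ} {κ l : ℝ} (hz : Tendsto z atTop (𝓝 l))
    (hs : ∀ M, κ + Real.exp l < M → ∀ᶠ t in essTop, s t < M) :
    Tendsto (fun t => gFun κ (s t) (z t)) essTop (𝓝 0) := by
  have h1 : Tendsto (fun t => max (s t - κ - Real.exp (z t)) 0) essTop (𝓝 0) := by
    refine tendsto_order.2 ⟨fun a ha => Eventually.of_forall fun t =>
      ha.trans_le (le_max_right _ _), fun η hη => ?_⟩
    have h2 : Tendsto (fun t => Real.exp (z t)) essTop (𝓝 (Real.exp l)) :=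
      ((Real.continuous_exp.tendsto l).comp hz).mono_left inf_le_left
    filter_upwards [hs (κ + Real.exp l + η / 2) (by linarith),
      h2.eventually (lt_mem_nhds (show Real.exp l - η / 2 < Real.exp l by linarith))] with t h3 h4
    exact max_lt (by linarith) hη
  have h2 := h1.pow 2
  simpa [gFun] using h2

/-- The state converges to zero as soon as the limit of the dynamic gain dominates the upper limit
of the parameters. -/
theorem tendsto_lyapunov_zero (hp : p.Valid) (hφ : ∀ y, 0 ≤ φ y) (hP : IsDesign p φ P₁ P₂ P₃)
    (hc : 0 < c) (hLK : UncertaintyBounds φ L K₁ K₂) (hi : i.Admissible)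
    (hsol : IsSolution p P₁ P₂ P₃ c L K₁ K₂ i w W y z) (hd : Tendsto i.d essTop (𝓝 0))
    (hδ : Tendsto i.δ essTop (𝓝 0)) (hb : 1 / p.κ ≤ liminf i.b essTop) {l : ℝ}
    (hl : Tendsto z atTop (𝓝 l))
    (h₁ : ∀ M, p.κ + Real.exp l < M →
      ∀ᶠ t in essTop, R * paramNorm c (i.θ₁₁ t) (i.θ₁₂ t) < M)
    (h₂ : ∀ M, p.κ + Real.exp l < M → ∀ᶠ t in essTop, |i.θ₂ t| < M) :
    Tendsto (lyapunov c w y) atTop (𝓝 0) := by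
  have hκ := hp.κ_pos
  have hμ := mu_pos hp hc
  have hez := Real.exp_pos (z 0)
  -- Eventually b > β because β < 1/κ, while 1/β < κ + e^{z(0)} makes the term g(1/β, z) vanish. The
  -- positivity of e^{z(0)} leaves the room that permits liminf b = 1/κ.
  obtain ⟨β, hβ1, hβ2⟩ := exists_between (show 1 / (p.κ + Real.exp (z 0)) < 1 / p.κ from
    one_div_lt_one_div_of_lt hκ (by linarith))
  have hβ : 0 < β := lt_trans (by positivity) hβ1
  have hbb : essTop.IsBoundedUnder (· ≥ ·) i.b :=
    ⟨0, Filter.eventually_map.2 (eventually_essTop_of_ae (hi.b_pos.mono fun _ h => h.le))⟩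
  have hbβ := eventually_lt_of_lt_liminf (hβ2.trans_le hb) hbb
  have hE : Tendsto (fun t => G c * ‖i.δ t‖ ^ 2 +
        p.a / (p.κ + Real.exp (z t)) * (i.d t ^ 2 + gFun p.κ |i.θ₂ t| (z t)
          + gFun p.κ |i.θ₂ t| (z t) ^ 2
          + gFun p.κ (R * paramNorm c (i.θ₁₁ t) (i.θ₁₂ t)) (z t) ^ 2)) essTop
      (𝓝 (G c * ‖(0 : L2)‖ ^ 2 + p.a / (p.κ + Real.exp l) *
        ((0 : ℝ) ^ 2 + 0 + (0 : ℝ) ^ 2 + (0 : ℝ) ^ 2))) := by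
    have hq : Tendsto (fun t => p.a / (p.κ + Real.exp (z t))) essTop
        (𝓝 (p.a / (p.κ + Real.exp l))) :=
      tendsto_const_nhds.div (tendsto_const_nhds.add
        (((Real.continuous_exp.tendsto l).comp hl).mono_left inf_le_left)) (by positivity)
    exact ((hδ.norm.pow 2).const_mul _).add (hq.mul ((((hd.pow 2).add
      (tendsto_gFun_zero hl h₂)).add ((tendsto_gFun_zero hl h₂).pow 2)).add
      ((tendsto_gFun_zero hl h₁).pow 2)))
  have hE0 : G c * ‖(0 : L2)‖ ^ 2 + p.a / (p.κ + Real.exp l) *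
      ((0 : ℝ) ^ 2 + 0 + (0 : ℝ) ^ 2 + (0 : ℝ) ^ 2) = 0 := by simp
  rw [hE0] at hE
  refine tendsto_order.2 ⟨fun a ha => Eventually.of_forall fun t => ha.trans_le ?_,
    fun η hη => ?_⟩
  · exact le_trans (by have := lowerConst_pos hc; positivity) (lyapunov_lower hc w y t)
  · refine hsol.locallyAC_lyapunov.eventually_lt (K := η / 2) hμ (by linarith) ?_
    filter_upwards [eventually_essTop_of_ae (hsol.deriv_lyapunov_le hp hφ hP hc hLK), hbβ,
      eventually_essTop_of_ae (ae_restrict_mem measurableSet_Ici),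
      hE.eventually (gt_mem_nhds (show 0 < mu p c * (η / 2) by positivity))] with t h3 h4 h5 h6
    have h7 := h3 β hβ h4.le
    have h8 : gFun p.κ (1 / β) (z t) = 0 := by
      have h9 : z 0 ≤ z t := hsol.monotoneOn_gain hp self_mem_Ici h5 h5
      have h10 := Real.exp_le_exp.2 h9
      have h11 : 1 / β < p.κ + Real.exp (z 0) :=
        (one_div_lt (by positivity) hβ).1 hβ1
      rw [gFun, max_eq_right (by linarith)]
      norm_num
    rw [h8, mul_zero, add_zero] at h7
    linarith

end IsSolution

end DADS

end

/-! ### Assembly of the estimates. -/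

theorem corollary3 (p : DADS.Gains) (hp : p.Valid)
    (φ : ℝ → ℝ) (hφ : ContDiff ℝ ∞ φ) (hφ0 : ∀ y, 0 ≤ φ y)
    (P₁ P₂ P₃ : ℝ → ℝ) (hP : DADS.IsDesign p φ P₁ P₂ P₃)
    (c : ℝ) (hc : 0 < c)
    (L : DADS.H1 → ℝ → ℝ) (K₁ : ℝ → ℝ → ℝ) (K₂ : ℝ → ℝ)
    (hLK : DADS.UncertaintyBounds φ L K₁ K₂)
    (i : DADS.Inputs) (hi : i.Admissible)
    (w : ℝ → DADS.L2) (W : ℝ → DADS.H1) (y z : ℝ → ℝ)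
    (hsol : DADS.IsSolution p P₁ P₂ P₃ c L K₁ K₂ i w W y z) :
    (∀ t : ℝ, 0 ≤ t →
      2 * DADS.lowerConst c * ‖w t‖ ^ 2 + |y t| ^ 2
        ≤ Real.exp (-DADS.mu p c * t) * (2 * DADS.upperConst c * ‖w 0‖ ^ 2 + |y 0| ^ 2)
          + 2 * (DADS.mu p c)⁻¹ * DADS.ZConst p c i (z 0)) ∧
    (∀ t : ℝ, 0 ≤ t →
      z 0 ≤ z t ∧
      z t ≤ Real.log (Real.exp (z 0) + p.Γ / (4 * p.C) * |y 0| ^ 2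
        + p.a * DADS.BConst p c i (w 0) (y 0) (z 0) *
          ((2 * p.C * (1 + Real.exp (z 0)) + p.ε * p.Γ)
            / (4 * p.C ^ 2 * p.ε * min 1 p.κ * (1 + Real.exp (z 0)))))) ∧
    limsup (fun t => ‖w t‖) atTop
      ≤ Real.sqrt (DADS.upperConst c / DADS.lowerConst c *
        (2 * p.ε * DADS.R ^ 2 *
            limsup (fun t => DADS.paramNorm c (i.θ₁₁ t) (i.θ₁₂ t)) DADS.essTop ^ 2
          + DADS.G c * limsup (fun t => ‖i.δ t‖) DADS.essTop ^ 2)) ∧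
    limsup (fun t => |y t|) atTop ≤ Real.sqrt (2 * p.ε) ∧
    (Tendsto i.d DADS.essTop (𝓝 0) →
      Tendsto i.δ DADS.essTop (𝓝 0) →
      1 / p.κ ≤ liminf i.b DADS.essTop →
      ∃ zlim : ℝ, Tendsto z atTop (𝓝 zlim) ∧
        ((Tendsto (fun t => |y t|) atTop (𝓝 0) ∧ Tendsto (fun t => ‖w t‖) atTop (𝓝 0)) ∨
          p.κ + Real.exp zlim <
            limsup (fun t => max
              (Real.sqrt (2 * Real.exp 1 * i.θ₁₂ t ^ 2
                + 8 * Real.exp 1 ^ 2 / c ^ 2 * ‖i.θ₁₁ t‖ ^ 2))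
              |i.θ₂ t|) DADS.essTop)) := by
  refine ⟨fun t ht => hsol.norm_sq_le hp hφ0 hP hc hLK hi ht, fun t ht => ⟨?_, ?_⟩,
    hsol.limsup_norm_le hp hφ0 hP hc hLK hi, hsol.limsup_abs_le hp hφ0 hP hc hLK hi, ?_⟩
  · exact hsol.monotoneOn_gain hp self_mem_Ici ht ht
  · have h := hsol.exp_gain_le hp hφ0 hP hc hLK hi ht
    exact (Real.le_log_iff_exp_le ((Real.exp_pos _).trans_le h)).2 h
  · intro hd hδ hb
    obtain ⟨l, hl⟩ := hsol.exists_tendsto_gain hp hφ0 hP hc hLK hi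
    refine ⟨l, hl, or_iff_not_imp_right.2 fun hlt => ?_⟩
    simp only [← DADS.R_mul_paramNorm] at hlt
    have hbdd : DADS.essTop.IsBoundedUnder (· ≤ ·)
        (fun t => max (DADS.R * DADS.paramNorm c (i.θ₁₁ t) (i.θ₁₂ t)) |i.θ₂ t|) := by
      refine ⟨max (DADS.R * DADS.supNorm fun t => DADS.paramNorm c (i.θ₁₁ t) (i.θ₁₂ t))
        (DADS.supNorm i.θ₂), Filter.eventually_map.2 (DADS.eventually_essTop_of_ae ?_)⟩
      filter_upwards [hi.ae_paramNorm_le c, DADS.ae_norm_le_supNorm hi.θ₂_mem.2] with t h1 h2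
      exact max_le_max (mul_le_mul_of_nonneg_left h1 DADS.R_pos.le) h2
    have hev : ∀ M, p.κ + Real.exp l < M → ∀ᶠ t in DADS.essTop,
        max (DADS.R * DADS.paramNorm c (i.θ₁₁ t) (i.θ₁₂ t)) |i.θ₂ t| < M := fun M hM =>
      eventually_lt_of_limsup_lt ((not_lt.1 hlt).trans_lt hM) hbdd
    exact DADS.IsSolution.tendsto_of_tendsto_lyapunov hc
      (hsol.tendsto_lyapunov_zero hp hφ0 hP hc hLK hi hd hδ hb hl
        (fun M hM => (hev M hM).mono fun t ht => (le_max_left _ _).trans_lt ht)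
        (fun M hM => (hev M hM).mono fun t ht => (le_max_right _ _).trans_lt ht))
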